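/- Let $(\phi_n)_{n\ge 1}$ be functions $\phi_n:\mathbb{R}\to\mathbb{C}$ with $\sup_n\|\phi_n\|_\infty<\infty$ for which there are constants $L\ge 1$ and $\delta>0$ such that $$L^{-1}|x-y|\le |\phi_n(x)-\phi_n(y)|\le L|x-y|\qquad\text{whenever } |x-y|\le\delta,\ n\ge 1.$$ Let $a_n\in\mathbb{C}\setminus\{0\}$ with $\sum_{n\ge1}|a_n|<\infty$, and let $(\lambda_n)_{n\ge 1}$ be a nondecreasing real sequence with $\lambda_1=1$ and $q:=\sup_n\lambda_{n+1}/\lambda_n\in(1,\infty)$ (if $(\lambda_n)$ is strictly increasing, $q>1$ is automatic). Put $$s_k=\Bigl(\sum_{q^k\le\lambda_n<q^{k+1}}|a_n|^2\Bigr)^{1/2},\qquad \tau=\limsup_{k\to\infty}\frac{-\log s_k}{k\log q}\in[-\infty,\infty],\qquad -\log 0:=+\infty.$$ Let $\theta_1,\theta_2,\dots$ be independent random variables, each uniformly distributed on $[0,1]$, and let $$S(x)=\sum_{n=1}^\infty a_n e^{2\pi i\theta_n}\phi_n(\lambda_n x),\qquad x\in\mathbb{R}.$$ For a finite Borel measure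 $\mu$ on $\mathbb{C}=\mathbb{R}^2$ let $\widehat\mu(\xi)=\int e^{-2\pi i\langle\xi,u\rangle}\,d\mu(u)$ and $$\dim_{\mathcal S}\mu=\sup\Bigl\{s>0:\int_{\mathbb{R}^2}|\widehat\mu(\xi)|^2|\xi|^{s-2}\,d\xi<\infty\Bigr\}\in[0,\infty]\qquad(\sup\emptyset=0).$$ For $E\subset\mathbb{R}^2$ let $\dim_{\mathcal S}E\in[0,\infty]$ be the supremum of $\dim_{\mathcal S}\mu$ over all nonzero finite Borel measures $\mu$ on $\mathbb{R}^2$ whose support is a compact subset of $E$ (again $\sup\emptyset=0$). **Theorem 3.4.** If $0\le\tau<\infty$, then for every Borel set $A\subset\mathbb{R}$ with $\dim_{\mathcal H}A>0$, almost surely $$\dim_{\mathcal S}S(A)\ \ge\ \frac{\dim_{\mathcal H}A}{\tau},$$ where the right-hand side is $+\infty$ when $\tau=0$. -/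

import Mathlib

open MeasureTheory ProbabilityTheory Filter
open scoped ENNReal NNReal

noncomputable section

/-- Fourier transform of a measure on the plane `ℂ = ℝ²`:
`μ̂(ξ) = ∫ exp(-2πi ⟨ξ, u⟩) dμ(u)`, where `⟨ξ, u⟩ = Re (conj ξ * u)` is the Euclidean inner
product. -/
def measureFourier (μ : Measure ℂ) (ξ : ℂ) : ℂ :=
  ∫ u : ℂ, Complex.exp (-2 * (Real.pi : ℂ) * Complex.I * ((inner ℝ ξ u : ℝ) : ℂ)) ∂μ

/-- The Sobolev energy `∫_{ℝ²} |μ̂(ξ)|² |ξ|^(s-2) dξ ∈ [0, ∞]` of a measure on the plane. -/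
def sobolevEnergy (μ : Measure ℂ) (s : ℝ) : ℝ≥0∞ :=
  ∫⁻ ξ : ℂ, ENNReal.ofReal (‖measureFourier μ ξ‖ ^ 2 * ‖ξ‖ ^ (s - 2))

/-- Sobolev dimension in `[0, ∞]` of a finite Borel measure on the plane: the supremum of all
`s > 0` with finite Sobolev energy (and `0` if there is none). -/
def sobolevDimMeasure (μ : Measure ℂ) : ℝ≥0∞ :=
  ⨆ (s : ℝ≥0) (_ : 0 < s ∧ sobolevEnergy μ s < ∞), (s : ℝ≥0∞)

/-- `μ` is a nonzero finite Borel measure whose closed support is a compact subset of `E`. -/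
def SupportedMeasure (E : Set ℂ) (μ : Measure ℂ) : Prop :=
  IsFiniteMeasure μ ∧ μ ≠ 0 ∧ ∃ K : Set ℂ, IsCompact K ∧ K ⊆ E ∧ μ Kᶜ = 0

/-- Sobolev dimension of a planar set: the supremum of the Sobolev dimensions of the nonzero
finite Borel measures supported on it. -/
def sobolevDim (E : Set ℂ) : ℝ≥0∞ :=
  ⨆ (μ : Measure ℂ) (_ : SupportedMeasure E μ), sobolevDimMeasure μ

open Classical in
/-- `s_k = (∑_{q^k ≤ λ_n < q^(k+1)} |a_n|²)^(1/2)`. -/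
def blockNorm (q : ℝ) (lam : ℕ → ℝ) (a : ℕ → ℂ) (k : ℕ) : ℝ :=
  Real.sqrt (∑' n : ℕ, if q ^ k ≤ lam n ∧ lam n < q ^ (k + 1) then ‖a n‖ ^ 2 else 0)

/-- `limsup_k (-log s_k) / (k log q)` in the extended reals, with `-log 0 = +∞`. -/
def decayExponent (q : ℝ) (lam : ℕ → ℝ) (a : ℕ → ℂ) : EReal :=
  limsup (fun k : ℕ => -(ENNReal.log (ENNReal.ofReal (blockNorm q lam a k))) /
    (((k : ℝ) * Real.log q : ℝ) : EReal)) atTop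

/-- The series `∑_n a_n exp(2πi t_n) φ_n(λ_n x)` with phases `t`. -/
def phaseSeries (a : ℕ → ℂ) (lam : ℕ → ℝ) (φ : ℕ → ℝ → ℂ) (t : ℕ → ℝ) (x : ℝ) : ℂ :=
  ∑' n : ℕ, a n * Complex.exp (2 * (Real.pi : ℂ) * Complex.I * (t n : ℂ)) * φ n (lam n * x)

end

/-! Suppose `s * τ < dimH A`. By Frostman's lemma some compact `K ⊆ A` of small diameter carries
a measure `ν ≠ 0` of finite Riesz `s * τ`-energy. For the image measure of `ν` under the random
series `S`, Fubini turns the mean squared Fourier transform into the `ν × ν`-average of the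
characteristic functions of the increments `S(x) - S(y)`. By independence each of these is a
product of factors `J₀(2π|ξ| |aₙ| |φₙ(λₙx) - φₙ(λₙy)|)`, all of modulus at most `1`. Since `τ`
exceeds the decay exponent, every late block of coefficients has `ℓ²` mass at least `q^(-τk)`; as
`|J₀(t)| ≤ (1 + t²)^(-κ)`, each block at the scale `λₙ ≈ 1/|x - y|` contributes a factor
`(1 + (b |x - y|^τ |ξ|)²)^(-κ)`. Using `m` consecutive blocks multiplies `κ` by `m`, so that for `m` large
the integral against `|ξ|^(s-2)` converges, and by scaling it is of order `|x - y|^(-sτ)`, which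
is `ν × ν`-integrable. Hence the image measure almost surely has finite Sobolev energy of order
`s`. -/

/-! ### Capacitability of analytic sets -/

section Capacitability

variable {β : Type*} [CompleteLinearOrder β] {t : β}

lemma exists_forall_lt_le_subset_of_isOpen {m : ℕ → ℕ} {V : Set (ℕ → ℕ)} (hV : IsOpen V)
    (h : Set.Iic m ⊆ V) : ∃ k, {x | ∀ i < k, x i ≤ m i} ⊆ V := by
  by_contra! hcon
  choose x hx hxV using fun k => Set.not_subset.1 (hcon k)
  have hbox : IsCompact (Set.pi Set.univ fun i => Set.Iic (m i)) :=
    isCompact_univ_pi fun i => (Set.finite_Iic (m i)).isCompact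
  obtain ⟨y, hy, ψ, hψ, hlim⟩ := hbox.tendsto_subseq (x := fun k i => min (x k i) (m i))
    fun k i _ => min_le_right (x k i) (m i)
  have hxlim : Tendsto (x ∘ ψ) atTop (nhds y) := by
    rw [tendsto_pi_nhds] at hlim ⊢
    intro i
    refine (hlim i).congr' ?_
    filter_upwards [eventually_gt_atTop i] with k hk
    exact min_eq_left (hx _ i (hk.trans_le hψ.le_apply))
  exact hV.isClosed_compl.mem_of_tendsto hxlim (Eventually.of_forall fun k => hxV (ψ k))
    (h fun i => hy i trivial)

lemma exists_forall_lt_of_lt_univ {c : Set (ℕ → ℕ) → β}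
    (hc : ∀ E : ℕ → Set (ℕ → ℕ), Monotone E → c (⋃ n, E n) ≤ ⨆ n, c (E n))
    (ht : t < c Set.univ) : ∃ m : ℕ → ℕ, ∀ k, t < c {x | ∀ i < k, x i ≤ m i} := by
  have cut (k : ℕ) (S : {S // t < c S}) : ∃ m, t < c (S.1 ∩ {x | x k ≤ m}) := by
    have hS : ⋃ m, S.1 ∩ {x | x k ≤ m} = S.1 := by
      rw [← Set.inter_iUnion]
      exact Set.inter_eq_left.2 fun x _ => Set.mem_iUnion.2 ⟨x k, le_refl (x k)⟩
    refine lt_iSup_iff.1 ((hS ▸ S.2).trans_le (hc _ fun i j hij => ?_))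
    exact Set.inter_subset_inter_right _ fun x hx => le_trans hx hij
  choose cutoff hcutoff using cut
  let S (k : ℕ) : {S // t < c S} :=
    Nat.rec ⟨Set.univ, ht⟩ (fun k S => ⟨S.1 ∩ {x | x k ≤ cutoff k S}, hcutoff k S⟩) k
  refine ⟨fun k => cutoff k (S k), fun k => ?_⟩
  suffices hS : (S k).1 = {x | ∀ i < k, x i ≤ cutoff i (S i)} from hS ▸ (S k).2
  induction k with
  | zero => simp [S]
  | succ k ih =>
    change (S k).1 ∩ {x | x k ≤ cutoff k (S k)} = _
    rw [ih]
    ext x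
    simp only [Set.mem_inter_iff, Set.mem_ofPred_eq, Nat.forall_lt_succ_right]

lemma exists_isCompact_forall_isOpen_lt {X : Type*} [TopologicalSpace X] {c : Set X → β}
    (hmono : Monotone c) (hc : ∀ E : ℕ → Set X, Monotone E → c (⋃ n, E n) ≤ ⨆ n, c (E n))
    {A : Set X} (hA : AnalyticSet A) (ht : t < c A) :
    ∃ K ⊆ A, IsCompact K ∧ ∀ O, IsOpen O → K ⊆ O → t < c O := by
  rw [AnalyticSet] at hA
  obtain rfl | ⟨g, hg, rfl⟩ := hA
  · exact ⟨∅, subset_rfl, isCompact_empty, fun O _ _ => ht.trans_le (hmono O.empty_subset)⟩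
  have hc_image (E : ℕ → Set (ℕ → ℕ)) (hE : Monotone E) :
      c (g '' ⋃ n, E n) ≤ ⨆ n, c (g '' E n) := by
    rw [Set.image_iUnion]
    exact hc _ fun i j hij => Set.image_mono (hE hij)
  obtain ⟨m, hm⟩ := exists_forall_lt_of_lt_univ (c := fun S => c (g '' S)) hc_image
    (by rwa [Set.image_univ])
  have hbox : IsCompact (Set.Iic m) := by
    rw [← Set.pi_univ_Iic]
    exact isCompact_univ_pi fun i => (Set.finite_Iic (m i)).isCompact
  refine ⟨g '' Set.Iic m, Set.image_subset_range _ _, hbox.image hg, fun O hO hKO => ?_⟩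
  obtain ⟨k, hk⟩ := exists_forall_lt_le_subset_of_isOpen (hO.preimage hg)
    (Set.image_subset_iff.1 hKO)
  exact (hm k).trans_le (hmono (Set.image_subset_iff.2 hk))

end Capacitability

/-! ### Dyadic content on the line -/

section DyadicContent

variable {p p' : ℕ × ℤ} {U V : Set (ℕ × ℤ)} {w : ℕ → ℝ≥0∞} {E F : Set ℝ}

/-- The half-open dyadic interval `[k / 2 ^ n, (k + 1) / 2 ^ n)` indexed by `p = (n, k)`. -/
def dyadicIco (p : ℕ × ℤ) : Set ℝ := {x | ⌊(2 : ℝ) ^ p.1 * x⌋ = p.2}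

/-- The set covered by a family of dyadic intervals. -/
def dyadicUnion (U : Set (ℕ × ℤ)) : Set ℝ := ⋃ p ∈ U, dyadicIco p

/-- The maximal intervals of a family of dyadic intervals. -/
def coarsest (U : Set (ℕ × ℤ)) : Set (ℕ × ℤ) :=
  {p ∈ U | ∀ p' ∈ U, (dyadicIco p ∩ dyadicIco p').Nonempty → p.1 ≤ p'.1}

/-- The total cost of a family of dyadic intervals, as a measure on the index set, when each
interval of level `n` costs `w n`. -/
noncomputable def familyCost (w : ℕ → ℝ≥0∞) : Measure (ℕ × ℤ) :=
  Measure.count.withDensity fun p => w p.1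

lemma mem_dyadicUnion {x : ℝ} : x ∈ dyadicUnion U ↔ ∃ p ∈ U, x ∈ dyadicIco p := by
  simp [dyadicUnion]

lemma dyadicUnion_mono (h : U ⊆ V) : dyadicUnion U ⊆ dyadicUnion V :=
  Set.biUnion_subset_biUnion_left h

lemma floor_two_pow_eq_of_le {n m : ℕ} (h : n ≤ m) {x y : ℝ}
    (hxy : ⌊(2 : ℝ) ^ m * x⌋ = ⌊(2 : ℝ) ^ m * y⌋) : ⌊(2 : ℝ) ^ n * x⌋ = ⌊(2 : ℝ) ^ n * y⌋ := by
  obtain ⟨d, rfl⟩ := Nat.exists_eq_add_of_le h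
  have floor_div (z : ℝ) : ⌊(2 : ℝ) ^ n * z⌋ = ⌊(2 : ℝ) ^ (n + d) * z⌋ / ((2 ^ d : ℕ) : ℤ) := by
    rw [← Int.floor_div_natCast]
    congr 1
    push_cast
    rw [pow_add]
    field_simp
  rw [floor_div, floor_div, hxy]

lemma dyadicIco_subset (h : p.1 ≤ p'.1) (hpp' : (dyadicIco p ∩ dyadicIco p').Nonempty) :
    dyadicIco p' ⊆ dyadicIco p := by
  obtain ⟨x, hxp, hxp'⟩ := hpp'
  intro y hy
  exact (floor_two_pow_eq_of_le h (Eq.trans hy (Eq.symm hxp'))).trans hxp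

lemma coarsest_inter_subset (h : V ⊆ U) : coarsest U ∩ V ⊆ coarsest V :=
  fun _ hp => ⟨hp.2, fun p' hp' => hp.1.2 p' (h hp')⟩

lemma coarsest_union_subset : coarsest (U ∪ V) ⊆ coarsest (coarsest U ∪ V) := by
  refine fun p hp => ⟨hp.1.imp_left fun hpU => ?_, fun p' hp' => hp.2 p' ?_⟩
  · exact coarsest_inter_subset Set.subset_union_left ⟨hp, hpU⟩
  · exact hp'.imp_left And.left

lemma dyadicUnion_coarsest (U : Set (ℕ × ℤ)) : dyadicUnion (coarsest U) = dyadicUnion U := by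
  classical
  refine (dyadicUnion_mono (Set.sep_subset _ _)).antisymm fun x hx => ?_
  have hex : ∃ n, ∃ p ∈ U, p.1 = n ∧ x ∈ dyadicIco p := by
    obtain ⟨p, hp, hxp⟩ := mem_dyadicUnion.1 hx
    exact ⟨p.1, p, hp, rfl, hxp⟩
  obtain ⟨p, hp, hpn, hxp⟩ := Nat.find_spec hex
  refine mem_dyadicUnion.2 ⟨p, ⟨hp, fun p' hp' hpp' => ?_⟩, hxp⟩
  by_contra! hlt
  have hxp' : x ∈ dyadicIco p' := dyadicIco_subset hlt.le (by rwa [Set.inter_comm]) hxp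
  exact (Nat.find_min' hex ⟨p', hp', rfl, hxp'⟩).not_gt (hpn ▸ hlt)

lemma inter_subset_dyadicUnion_finer (hU : E ⊆ dyadicUnion U) (hV : F ⊆ dyadicUnion V) :
    E ∩ F ⊆ dyadicUnion ((U ∪ V) \ coarsest (U ∪ V) ∪ U ∩ V) := by
  rintro x ⟨hxE, hxF⟩
  obtain ⟨u, hu, hxu⟩ := mem_dyadicUnion.1 (hU hxE)
  obtain ⟨v, hv, hxv⟩ := mem_dyadicUnion.1 (hV hxF)
  rw [mem_dyadicUnion]
  rcases lt_trichotomy u.1 v.1 with h | h | h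
  · exact ⟨v, Or.inl ⟨Or.inr hv, fun hmax => (hmax.2 u (Or.inl hu) ⟨x, hxv, hxu⟩).not_gt h⟩, hxv⟩
  · have huv : u = v := by
      refine Prod.ext h (Eq.trans (Eq.symm hxu) (Eq.trans ?_ hxv))
      rw [h]
    exact ⟨u, Or.inr ⟨hu, huv ▸ hv⟩, hxu⟩
  · exact ⟨u, Or.inl ⟨Or.inl hu, fun hmax => (hmax.2 v (Or.inr hv) ⟨x, hxu, hxv⟩).not_gt h⟩, hxu⟩

/-- The net content of a subset of the line: the infimum of the costs of its coverings by families
of dyadic intervals, when each interval of level `n` costs `w n`. -/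
noncomputable def dyadicContent (w : ℕ → ℝ≥0∞) : OuterMeasure ℝ where
  measureOf E := ⨅ (U : Set (ℕ × ℤ)) (_ : E ⊆ dyadicUnion U), familyCost w U
  empty := le_antisymm
    (iInf₂_le_of_le (∅ : Set (ℕ × ℤ)) (Set.empty_subset _) measure_empty.le) zero_le
  mono h := le_iInf₂ fun U hU => iInf₂_le U (h.trans hU)
  iUnion_nat E _ := by
    refine ENNReal.le_of_forall_pos_le_add fun ε hε hfin => ?_
    obtain ⟨e, he, hesum⟩ := ENNReal.exists_pos_sum_of_countable (ENNReal.coe_ne_zero.2 hε.ne') ℕ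
    have hcover (n : ℕ) : ∃ U, E n ⊆ dyadicUnion U ∧ familyCost w U <
        (⨅ (U : Set (ℕ × ℤ)) (_ : E n ⊆ dyadicUnion U), familyCost w U) + e n := by
      simpa only [iInf_lt_iff, exists_prop] using
        ENNReal.lt_add_right (ENNReal.ne_top_of_tsum_ne_top hfin.ne n)
          (ENNReal.coe_ne_zero.2 (he n).ne')
    choose U hU hUcost using hcover
    refine iInf₂_le_of_le (⋃ n, U n) (Set.iUnion_subset fun n =>
      (hU n).trans (dyadicUnion_mono (Set.subset_iUnion U n))) ?_
    calc familyCost w (⋃ n, U n) ≤ ∑' n, familyCost w (U n) := measure_iUnion_le U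
      _ ≤ _ := ENNReal.tsum_le_tsum fun n => (hUcost n).le
      _ ≤ _ := ENNReal.tsum_add.trans_le (by gcongr)

lemma dyadicContent_apply (w : ℕ → ℝ≥0∞) (E : Set ℝ) :
    dyadicContent w E = ⨅ (U : Set (ℕ × ℤ)) (_ : E ⊆ dyadicUnion U), familyCost w U := rfl

lemma dyadicContent_le (h : E ⊆ dyadicUnion U) : dyadicContent w E ≤ familyCost w U :=
  (dyadicContent_apply w E).trans_le (iInf₂_le U h)

lemma exists_familyCost_lt {t : ℝ≥0∞} (h : dyadicContent w E < t) :
    ∃ U, E ⊆ dyadicUnion U ∧ familyCost w U < t := by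
  simpa only [dyadicContent_apply, iInf_lt_iff, exists_prop] using h

/-- Strong subadditivity, at the level of coverings: the maximal intervals cover `E ∪ F`, and the
remaining ones still cover `E ∩ F`. -/
lemma familyCost_coarsest_add_dyadicContent_le (hU : E ⊆ dyadicUnion U) (hV : F ⊆ dyadicUnion V) :
    familyCost w (coarsest (U ∪ V)) + dyadicContent w (E ∩ F) ≤
      familyCost w U + familyCost w V := by
  set R := (U ∪ V) \ coarsest (U ∪ V) ∪ U ∩ V
  have hunion : coarsest (U ∪ V) ∪ R ⊆ U ∪ V :=
    Set.union_subset (Set.sep_subset _ _) (Set.union_subset Set.sdiff_subset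
      (Set.inter_subset_left.trans Set.subset_union_left))
  have hinter : coarsest (U ∪ V) ∩ R ⊆ U ∩ V :=
    fun p hp => hp.2.resolve_left fun h => h.2 hp.1
  calc _ ≤ familyCost w (coarsest (U ∪ V)) + familyCost w R := by
        gcongr
        exact dyadicContent_le (inter_subset_dyadicUnion_finer hU hV)
    _ = familyCost w (coarsest (U ∪ V) ∪ R) + familyCost w (coarsest (U ∪ V) ∩ R) :=
        (measure_union_add_inter _ (.of_discrete)).symm
    _ ≤ familyCost w (U ∪ V) + familyCost w (U ∩ V) := by gcongr
    _ = _ := measure_union_add_inter _ .of_discrete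

lemma familyCost_coarsest_accumulate_le {E : ℕ → Set ℝ} (hE : Monotone E)
    (hfin : ∀ n, dyadicContent w (E n) ≠ ∞) {U : ℕ → Set (ℕ × ℤ)} {e : ℕ → ℝ≥0∞}
    (hU : ∀ n, E n ⊆ dyadicUnion (U n))
    (hcost : ∀ n, familyCost w (U n) ≤ dyadicContent w (E n) + e n) (n : ℕ) :
    familyCost w (coarsest (Set.accumulate U n)) ≤
      dyadicContent w (E n) + ∑ i ∈ Finset.range (n + 1), e i := by
  induction n with
  | zero =>
    rw [Set.accumulate_zero_nat, zero_add, Finset.sum_range_one]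
    exact (measure_mono (Set.sep_subset _ _)).trans (hcost 0)
  | succ n ih =>
    have hcover : E n ⊆ dyadicUnion (coarsest (Set.accumulate U n)) := by
      rw [dyadicUnion_coarsest]
      exact (hU n).trans (dyadicUnion_mono (Set.subset_accumulate))
    have hstrong := familyCost_coarsest_add_dyadicContent_le (w := w) hcover (hU (n + 1))
    rw [Set.inter_eq_left.2 (hE n.le_succ)] at hstrong
    rw [Set.accumulate_succ, Finset.sum_range_succ _ (n + 1)]
    refine (measure_mono coarsest_union_subset).trans
      ((ENNReal.add_le_add_iff_right (hfin n)).1 (hstrong.trans ?_))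
    exact (add_le_add ih (hcost (n + 1))).trans_eq (by ring)

/-- Unlike countable subadditivity, this continuity holds for increasing sequences of arbitrary
sets and is what makes the content a capacity. -/
lemma dyadicContent_iUnion_le {E : ℕ → Set ℝ} (hE : Monotone E) :
    dyadicContent w (⋃ n, E n) ≤ ⨆ n, dyadicContent w (E n) := by
  refine ENNReal.le_of_forall_pos_le_add fun ε hε hfin => ?_
  replace hfin (n : ℕ) : dyadicContent w (E n) ≠ ∞ :=
    ((le_iSup (fun n => dyadicContent w (E n)) n).trans_lt hfin).ne
  obtain ⟨e, he, hesum⟩ := ENNReal.exists_pos_sum_of_countable (ENNReal.coe_ne_zero.2 hε.ne') ℕ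
  choose U hU hcost using fun n => exists_familyCost_lt
    (ENNReal.lt_add_right (hfin n) (ENNReal.coe_ne_zero.2 (he n).ne'))
  have hcover : ⋃ n, E n ⊆ dyadicUnion (coarsest (⋃ n, U n)) := by
    rw [dyadicUnion_coarsest]
    exact Set.iUnion_subset fun n => (hU n).trans (dyadicUnion_mono (Set.subset_iUnion U n))
  have hexhaust : coarsest (⋃ n, U n) = ⋃ n, coarsest (⋃ n, U n) ∩ Set.accumulate U n := by
    rw [← Set.inter_iUnion, Set.iUnion_accumulate]
    exact (Set.inter_eq_left.2 (Set.sep_subset _ _)).symm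
  refine (dyadicContent_le hcover).trans ?_
  rw [hexhaust, Monotone.measure_iUnion fun i j hij =>
    Set.inter_subset_inter_right _ (Set.monotone_accumulate hij)]
  refine iSup_le fun n => ?_
  calc _ ≤ familyCost w (coarsest (Set.accumulate U n)) := measure_mono
        (coarsest_inter_subset ((Set.subset_iUnion _ n).trans Set.iUnion_accumulate.subset))
    _ ≤ dyadicContent w (E n) + ∑ i ∈ Finset.range (n + 1), (e i : ℝ≥0∞) :=
        familyCost_coarsest_accumulate_le hE hfin hU (fun n => (hcost n).le) n
    _ ≤ _ := add_le_add (le_iSup (fun n => dyadicContent w (E n)) n)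
        ((ENNReal.sum_le_tsum _).trans hesum.le)

lemma familyCost_eq_tsum (w : ℕ → ℝ≥0∞) (U : Set (ℕ × ℤ)) :
    familyCost w U = ∑' p : U, w p.1.1 := by
  rw [familyCost, withDensity_apply _ .of_discrete, ← lintegral_indicator .of_discrete,
    lintegral_count, tsum_subtype U fun p => w p.1]

lemma familyCost_preimage_shift (w : ℕ → ℝ≥0∞) (j : ℤ) (U : Set (ℕ × ℤ)) :
    familyCost w ((fun p => (p.1, p.2 + j)) ⁻¹' U) = familyCost w U := by
  simp only [familyCost_eq_tsum, tsum_subtype _ fun p : ℕ × ℤ => w p.1]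
  rw [← ((Equiv.refl ℕ).prodCongr (Equiv.addRight j)).tsum_eq (U.indicator _)]
  rfl

lemma exists_isOpen_between_dyadicUnion (w : ℕ → ℝ≥0∞) (U : Set (ℕ × ℤ)) :
    ∃ (O : Set ℝ) (V : Set (ℕ × ℤ)), IsOpen O ∧ dyadicUnion U ⊆ O ∧ O ⊆ dyadicUnion V ∧
      familyCost w V ≤ 3 * familyCost w U := by
  let shift (j : ℤ) : Set (ℕ × ℤ) := (fun p => (p.1, p.2 + j)) ⁻¹' U
  refine ⟨⋃ p ∈ U, {x : ℝ | (p.2 : ℝ) - 1 < 2 ^ p.1 * x ∧ (2 : ℝ) ^ p.1 * x < p.2 + 2},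
    ⋃ j ∈ Finset.Icc (-1 : ℤ) 1, shift j, ?_, ?_, ?_, ?_⟩
  · refine isOpen_biUnion fun p _ => ?_
    have h : Continuous fun x : ℝ => (2 : ℝ) ^ p.1 * x := by fun_prop
    exact (isOpen_lt continuous_const h).inter (isOpen_lt h continuous_const)
  · refine Set.biUnion_mono subset_rfl fun p _ x hx => ?_
    have hfloor := Int.floor_eq_iff.1 hx
    exact ⟨by linarith, by linarith⟩
  · refine Set.iUnion₂_subset fun p hp x ⟨hlow, hupp⟩ => ?_
    have hfloor_low : p.2 - 1 ≤ ⌊(2 : ℝ) ^ p.1 * x⌋ := Int.le_floor.2 (by push_cast; linarith)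
    have hfloor_upp : ⌊(2 : ℝ) ^ p.1 * x⌋ < p.2 + 2 := Int.floor_lt.2 (by push_cast; linarith)
    refine mem_dyadicUnion.2 ⟨(p.1, ⌊(2 : ℝ) ^ p.1 * x⌋), ?_, rfl⟩
    refine Set.mem_biUnion (x := p.2 - ⌊(2 : ℝ) ^ p.1 * x⌋) ?_ ?_
    · simp only [Finset.coe_Icc, Set.mem_Icc]
      omega
    · simpa [shift] using hp
  · calc familyCost w (⋃ j ∈ Finset.Icc (-1 : ℤ) 1, shift j)
        ≤ ∑ j ∈ Finset.Icc (-1 : ℤ) 1, familyCost w (shift j) := measure_biUnion_finset_le _ _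
      _ = 3 * familyCost w U := by
        simp only [shift, familyCost_preimage_shift, Finset.sum_const, Int.card_Icc, nsmul_eq_mul]
        rfl

lemma exists_isCompact_dyadicContent_pos {A : Set ℝ} (hA : AnalyticSet A)
    (hpos : 0 < dyadicContent w A) : ∃ K ⊆ A, IsCompact K ∧ 0 < dyadicContent w K := by
  obtain ⟨η, hη, hηA⟩ := exists_between hpos
  obtain ⟨K, hKA, hK, hKO⟩ := exists_isCompact_forall_isOpen_lt (c := dyadicContent w)
    (fun _ _ h => measure_mono h) (fun _ => dyadicContent_iUnion_le) hA hηA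
  refine ⟨K, hKA, hK, (ENNReal.div_pos hη.ne' (by norm_num : (3 : ℝ≥0∞) ≠ ∞)).trans_le ?_⟩
  by_contra! hlt
  obtain ⟨U, hU, hUcost⟩ := exists_familyCost_lt hlt
  obtain ⟨O, V, hO, hUO, hOV, hVcost⟩ := exists_isOpen_between_dyadicUnion w U
  refine (hKO O hO (hU.trans hUO)).not_ge ?_
  calc dyadicContent w O ≤ 3 * familyCost w U := (dyadicContent_le hOV).trans hVcost
    _ ≤ 3 * (η / 3) := by gcongr
    _ = η := ENNReal.mul_div_cancel (by norm_num) (by norm_num)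

/-- The cost `2 ^ (-n α)` of a dyadic interval of level `n` in dimension `α`. -/
noncomputable def netWeight (α : ℝ) (n : ℕ) : ℝ≥0∞ := ENNReal.ofReal ((1 / 2) ^ n) ^ α

lemma ediam_dyadicIco_le (p : ℕ × ℤ) :
    Metric.ediam (dyadicIco p) ≤ ENNReal.ofReal ((1 / 2) ^ p.1) := by
  refine Metric.ediam_le fun x hx y hy => ?_
  rw [edist_dist]
  apply ENNReal.ofReal_le_ofReal
  have hfloor := (Int.abs_sub_lt_one_of_floor_eq_floor (Eq.trans hx (Eq.symm hy))).le
  rw [← mul_sub, abs_mul, abs_of_pos (by positivity)] at hfloor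
  rw [Real.dist_eq, one_div, inv_pow, ← one_div, le_div_iff₀ (by positivity)]
  linarith

lemma hausdorffMeasure_eq_zero_of_dyadicContent_eq_zero {α : ℝ} (hα : 0 < α)
    (h : dyadicContent (netWeight α) E = 0) : μH[α] E = 0 := by
  let ε (n : ℕ) : ℝ≥0∞ := ((n + 1 : ℕ) : ℝ≥0∞)⁻¹
  have hε : Tendsto ε atTop (nhds 0) :=
    (tendsto_add_atTop_iff_nat 1).2 ENNReal.tendsto_inv_nat_nhds_zero
  have hcover (n : ℕ) : ∃ U, E ⊆ dyadicUnion U ∧ familyCost (netWeight α) U < ε n :=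
    exists_familyCost_lt (h ▸ by simp [ε])
  choose U hU hUcost using hcover
  have hdiam (p : ℕ × ℤ) : Metric.ediam (dyadicIco p) ^ α ≤ netWeight α p.1 :=
    ENNReal.rpow_le_rpow (ediam_dyadicIco_le p) hα.le
  have hsum (n : ℕ) : ∑' p : U n, Metric.ediam (dyadicIco p) ^ α ≤ ε n :=
    (ENNReal.tsum_le_tsum fun p : U n => hdiam p).trans
      ((familyCost_eq_tsum _ _).symm.trans_le (hUcost n).le)
  have hle := Measure.hausdorffMeasure_le_liminf_tsum α E (l := atTop) (fun n => ε n ^ α⁻¹)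
    (by simpa [ENNReal.zero_rpow_of_pos (inv_pos.2 hα)] using hε.ennrpow_const α⁻¹)
    (fun n (p : U n) => dyadicIco p) ?_ ?_
  · refine le_antisymm (hle.trans ?_) zero_le
    exact (liminf_le_liminf (.of_forall hsum)).trans hε.liminf_eq.le
  · refine .of_forall fun n p => ?_
    rw [ENNReal.le_rpow_inv_iff hα]
    exact (ENNReal.le_tsum p).trans (hsum n)
  · exact .of_forall fun n => (hU n).trans (Set.biUnion_eq_iUnion _ _).subset

lemma dyadicContent_Ioc_le {α : ℝ} (hα : 0 < α) {x y : ℝ} (hxy : x < y) (h1 : y - x ≤ 1) :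
    dyadicContent (netWeight α) (Set.Ioc x y) ≤ 2 * ENNReal.ofReal (2 * (y - x)) ^ α := by
  obtain ⟨n, hn, hn'⟩ := exists_nat_pow_near_of_lt_one (sub_pos.2 hxy) h1
    (by norm_num : (0 : ℝ) < 1 / 2) (by norm_num)
  set k := ⌊(2 : ℝ) ^ n * x⌋
  let U : Finset (ℕ × ℤ) := {(n, k), (n, k + 1)}
  have hcover : Set.Ioc x y ⊆ dyadicUnion U := by
    intro z hz
    have hlow : k ≤ ⌊(2 : ℝ) ^ n * z⌋ := Int.floor_le_floor (by gcongr; exact hz.1.le)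
    have hupp : ⌊(2 : ℝ) ^ n * z⌋ ≤ k + 1 := by
      rw [← Int.floor_add_one]
      refine Int.floor_le_floor ?_
      calc (2 : ℝ) ^ n * z = 2 ^ n * x + 2 ^ n * (z - x) := by ring
        _ ≤ 2 ^ n * x + 2 ^ n * (1 / 2) ^ n := by gcongr; linarith [hz.2]
        _ = 2 ^ n * x + 1 := by rw [← mul_pow]; norm_num
    refine mem_dyadicUnion.2 ⟨(n, ⌊(2 : ℝ) ^ n * z⌋), ?_, rfl⟩
    simp only [U, Finset.coe_insert, Finset.coe_singleton, Set.mem_insert_iff,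
      Set.mem_singleton_iff, Prod.mk.injEq, true_and]
    omega
  have hweight : netWeight α n ≤ ENNReal.ofReal (2 * (y - x)) ^ α := by
    rw [pow_succ] at hn
    refine ENNReal.rpow_le_rpow (ENNReal.ofReal_le_ofReal ?_) hα.le
    linarith
  calc dyadicContent (netWeight α) (Set.Ioc x y) ≤ familyCost (netWeight α) U :=
        dyadicContent_le hcover
    _ = netWeight α n + netWeight α n := by
        rw [familyCost_eq_tsum, U.tsum_subtype' fun p => netWeight α p.1,
          Finset.sum_pair (by simp)]
    _ ≤ 2 * ENNReal.ofReal (2 * (y - x)) ^ α := by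
        rw [two_mul]
        gcongr

lemma dyadicContent_lt_top_of_isCompact {α : ℝ} (hα : 0 < α) {K : Set ℝ} (hK : IsCompact K) :
    dyadicContent (netWeight α) K < ∞ := by
  refine hK.induction_on (p := fun E => dyadicContent (netWeight α) E < ∞) (by simp)
    (fun E F hEF hF => (measure_mono hEF).trans_lt hF)
    (fun E F hE hF => (measure_union_le E F).trans_lt (ENNReal.add_lt_top.2 ⟨hE, hF⟩))
    fun x _ => ⟨Set.Ioc (x - 1 / 2) (x + 1 / 2),
      mem_nhdsWithin_of_mem_nhds (Ioc_mem_nhds (by linarith) (by linarith)), ?_⟩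
  refine (dyadicContent_Ioc_le hα (by linarith) (by linarith)).trans_lt ?_
  exact ENNReal.mul_lt_top (by norm_num) (ENNReal.rpow_lt_top_of_nonneg hα.le ENNReal.ofReal_ne_top)

end DyadicContent

/-! ### Frostman's lemma -/

section Frostman

lemma exists_measure_Ioc_eq_sub (c : OuterMeasure ℝ) (hfin : c Set.univ ≠ ∞)
    (hright : ∀ x, Tendsto (fun y => c (Set.Ioc x y)) (nhdsWithin x (Set.Ioi x)) (nhds 0)) :
    ∃ ν : Measure ℝ, IsFiniteMeasure ν ∧
      ∀ x y, ν (Set.Ioc x y) = c (Set.Iic y) - c (Set.Iic x) := by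
  have hfin' (E : Set ℝ) : c E ≠ ∞ := ne_top_of_le_ne_top hfin (measure_mono E.subset_univ)
  have hcont (x : ℝ) : ContinuousWithinAt (fun y => c (Set.Iic y)) (Set.Ici x) x := by
    rw [← continuousWithinAt_Ioi_iff_Ici]
    have hupp := (hright x).const_add (c (Set.Iic x))
    rw [add_zero] at hupp
    refine tendsto_of_tendsto_of_tendsto_of_le_of_le' tendsto_const_nhds hupp ?_ ?_ <;>
      filter_upwards [self_mem_nhdsWithin] with y (hy : x < y)
    · exact measure_mono (Set.Iic_subset_Iic.2 hy.le)
    · rw [← Set.Iic_union_Ioc_eq_Iic hy.le]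
      exact measure_union_le _ _
  let F : StieltjesFunction ℝ :=
    { toFun x := (c (Set.Iic x)).toReal
      mono' x y hxy := ENNReal.toReal_mono (hfin' _) (measure_mono (Set.Iic_subset_Iic.2 hxy))
      right_continuous' x := (ENNReal.tendsto_toReal (hfin' _)).comp (hcont x) }
  refine ⟨F.measure, F.isFiniteMeasure_of_forall_abs_le (C := (c Set.univ).toReal) fun x => ?_,
    fun x y => ?_⟩
  · exact (abs_of_nonneg ENNReal.toReal_nonneg).trans_le
      (ENNReal.toReal_mono hfin (measure_mono (Set.subset_univ _)))
  · rw [F.measure_Ioc]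
    change ENNReal.ofReal ((c (Set.Iic y)).toReal - (c (Set.Iic x)).toReal) = _
    rw [ENNReal.ofReal_sub _ ENNReal.toReal_nonneg, ENNReal.ofReal_toReal (hfin' _),
      ENNReal.ofReal_toReal (hfin' _)]

lemma tendsto_dyadicContent_Ioc {α : ℝ} (hα : 0 < α) (x : ℝ) :
    Tendsto (fun y => dyadicContent (netWeight α) (Set.Ioc x y)) (nhdsWithin x (Set.Ioi x))
      (nhds 0) := by
  have hbound : Tendsto (fun y : ℝ => 2 * ENNReal.ofReal (2 * (y - x)) ^ α)
      (nhdsWithin x (Set.Ioi x)) (nhds 0) := by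
    have hlen : Tendsto (fun y : ℝ => ENNReal.ofReal (2 * (y - x))) (nhds x) (nhds 0) := by
      have hcont : Continuous fun y : ℝ => ENNReal.ofReal (2 * (y - x)) :=
        ENNReal.continuous_ofReal.comp (by fun_prop)
      simpa using hcont.tendsto x
    have hpow := ENNReal.Tendsto.const_mul (a := 2) (hlen.ennrpow_const α) (Or.inr (by norm_num))
    rw [ENNReal.zero_rpow_of_pos hα, mul_zero] at hpow
    exact hpow.mono_left nhdsWithin_le_nhds
  refine tendsto_of_tendsto_of_tendsto_of_le_of_le' tendsto_const_nhds hbound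
    (.of_forall fun _ => zero_le) ?_
  filter_upwards [Ioc_mem_nhdsGT (lt_add_one x)] with y hy
  exact dyadicContent_Ioc_le hα hy.1 (by linarith [hy.2])

lemma measure_compl_eq_zero_of_forall_Ioc {ν : Measure ℝ} {K : Set ℝ} (hK : IsClosed K)
    (h : ∀ x y, Disjoint (Set.Ioc x y) K → ν (Set.Ioc x y) = 0) : ν Kᶜ = 0 := by
  refine measure_null_of_locally_null _ fun x hx => ?_
  obtain ⟨l, u, hxlu, hlu⟩ := mem_nhds_iff_exists_Ioo_subset.1 (hK.isOpen_compl.mem_nhds hx)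
  obtain ⟨y, hxy, hyu⟩ := exists_between hxlu.2
  refine ⟨Set.Ioc l y, mem_nhdsWithin_of_mem_nhds (Ioc_mem_nhds hxlu.1 hxy), h l y ?_⟩
  exact Set.subset_compl_iff_disjoint_right.1 ((Set.Ioc_subset_Ioo_right hyu).trans hlu)

lemma exists_measure_Ioc_le_of_dyadicContent_pos {α : ℝ} (hα : 0 < α) {K : Set ℝ}
    (hK : IsCompact K) (hpos : 0 < dyadicContent (netWeight α) K) :
    ∃ ν : Measure ℝ, IsFiniteMeasure ν ∧ ν ≠ 0 ∧ ν Kᶜ = 0 ∧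
      ∀ x y, ν (Set.Ioc x y) ≤ dyadicContent (netWeight α) (Set.Ioc x y) := by
  let c := OuterMeasure.restrict K (dyadicContent (netWeight α))
  have c_apply (E : Set ℝ) : c E = dyadicContent (netWeight α) (E ∩ K) :=
    OuterMeasure.restrict_apply _ _ _
  have c_le (E : Set ℝ) : c E ≤ dyadicContent (netWeight α) E :=
    (c_apply E).trans_le (measure_mono Set.inter_subset_left)
  obtain ⟨ν, hfin, hν⟩ := exists_measure_Ioc_eq_sub c
    (by simpa only [c_apply, Set.univ_inter] using (dyadicContent_lt_top_of_isCompact hα hK).ne)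
    fun x => tendsto_of_tendsto_of_tendsto_of_le_of_le tendsto_const_nhds
      (tendsto_dyadicContent_Ioc hα x) (fun _ => zero_le) fun y => c_le _
  have hν_le (x y : ℝ) : ν (Set.Ioc x y) ≤ c (Set.Ioc x y) := by
    rw [hν, tsub_le_iff_left]
    refine (measure_mono fun z (hz : z ≤ y) => ?_).trans (measure_union_le _ _)
    exact (le_or_gt z x).imp_right fun h => ⟨h, hz⟩
  refine ⟨ν, hfin, ?_, measure_compl_eq_zero_of_forall_Ioc hK.isClosed fun x y hxy => ?_,
    fun x y => (hν_le x y).trans (c_le _)⟩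
  · rintro rfl
    obtain ⟨R, hR⟩ := hK.isBounded.subset_closedBall 0
    rw [Real.closedBall_eq_Icc] at hR
    have hlow : Set.Iic (0 - R - 1) ∩ K = ∅ :=
      Set.eq_empty_of_forall_notMem fun z ⟨hz, hzK⟩ => by linarith [(hR hzK).1, Set.mem_Iic.1 hz]
    have hupp : Set.Iic (0 + R) ∩ K = K := Set.inter_eq_right.2 fun z hz => (hR hz).2
    have hmass := hν (0 - R - 1) (0 + R)
    rw [c_apply, c_apply, hlow, hupp, measure_empty, tsub_zero] at hmass
    exact hpos.ne hmass
  · refine le_antisymm ((hν_le x y).trans ?_) zero_le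
    rw [c_apply, hxy.inter_eq, measure_empty]

/-- **Frostman's lemma** on the line. -/
theorem exists_measure_closedBall_le_rpow {A : Set ℝ} (hA : AnalyticSet A) {α : ℝ≥0} (hα : 0 < α)
    (hdim : α < dimH A) :
    ∃ K ⊆ A, IsCompact K ∧ ∃ ν : Measure ℝ, IsFiniteMeasure ν ∧ ν ≠ 0 ∧ ν Kᶜ = 0 ∧
      ∃ C : ℝ≥0∞, C ≠ ∞ ∧
        ∀ x, ∀ r > 0, ν (Metric.closedBall x r) ≤ C * ENNReal.ofReal r ^ (α : ℝ) := by
  have hα' : (0 : ℝ) < α := by exact_mod_cast hα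
  have hpos : 0 < dyadicContent (netWeight α) A := by
    refine pos_iff_ne_zero.2 fun h => ENNReal.top_ne_zero ?_
    rw [← hausdorffMeasure_of_lt_dimH hdim,
      hausdorffMeasure_eq_zero_of_dyadicContent_eq_zero hα' h]
  obtain ⟨K, hKA, hK, hKpos⟩ := exists_isCompact_dyadicContent_pos hA hpos
  obtain ⟨ν, hfin, hν0, hνK, hν⟩ := exists_measure_Ioc_le_of_dyadicContent_pos hα' hK hKpos
  have ofReal_mul_rpow {k : ℝ} (hk : 0 ≤ k) (r : ℝ) : ENNReal.ofReal (k * r) ^ (α : ℝ) =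
      ENNReal.ofReal k ^ (α : ℝ) * ENNReal.ofReal r ^ (α : ℝ) := by
    rw [ENNReal.ofReal_mul hk, ENNReal.mul_rpow_of_nonneg _ _ hα'.le]
  have hpow_ne (k : ℝ) : ENNReal.ofReal k ^ (α : ℝ) ≠ ∞ :=
    ENNReal.rpow_ne_top_of_nonneg hα'.le ENNReal.ofReal_ne_top
  refine ⟨K, hKA, hK, ν, hfin, hν0, hνK, 2 * ENNReal.ofReal 6 ^ (α : ℝ) +
    ν Set.univ * ENNReal.ofReal 3 ^ (α : ℝ), ?_, fun x r hr => ?_⟩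
  · exact ENNReal.add_ne_top.2 ⟨ENNReal.mul_ne_top (by norm_num) (hpow_ne 6),
      ENNReal.mul_ne_top (measure_ne_top _ _) (hpow_ne 3)⟩
  rw [add_mul, mul_assoc, mul_assoc, ← ofReal_mul_rpow (by norm_num),
    ← ofReal_mul_rpow (by norm_num)]
  rcases le_or_gt (3 * r) 1 with hr1 | hr1
  · have hsub : Metric.closedBall x r ⊆ Set.Ioc (x - 2 * r) (x + r) := by
      rw [Real.closedBall_eq_Icc]
      exact fun y hy => ⟨by linarith [hy.1], hy.2⟩
    refine le_add_of_le_of_nonneg ?_ zero_le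
    calc ν (Metric.closedBall x r) ≤ dyadicContent (netWeight α) (Set.Ioc (x - 2 * r) (x + r)) :=
          (measure_mono hsub).trans (hν _ _)
      _ ≤ 2 * ENNReal.ofReal (2 * (x + r - (x - 2 * r))) ^ (α : ℝ) :=
          dyadicContent_Ioc_le hα' (by linarith) (by linarith)
      _ = 2 * ENNReal.ofReal (6 * r) ^ (α : ℝ) := by ring_nf
  · refine le_add_of_nonneg_of_le zero_le ((measure_mono (Set.subset_univ _)).trans ?_)
    exact le_mul_of_one_le_right' (ENNReal.one_le_rpow (ENNReal.one_le_ofReal.2 hr1.le) hα')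

section Energy

variable {X : Type*} [MetricSpace X] [MeasurableSpace X]
  {ν : Measure X} {α : ℝ} {C : ℝ≥0∞}

lemma measure_singleton_eq_zero_of_closedBall_le (hα : 0 < α) (hC : C ≠ ∞) (x : X)
    (hν : ∀ r > 0, ν (Metric.closedBall x r) ≤ C * ENNReal.ofReal r ^ α) : ν {x} = 0 := by
  have hlim : Tendsto (fun r => C * ENNReal.ofReal r ^ α) (nhdsWithin 0 (Set.Ioi 0)) (nhds 0) := by
    have hpow := (ENNReal.continuous_ofReal.tendsto 0).ennrpow_const α
    rw [ENNReal.ofReal_zero, ENNReal.zero_rpow_of_pos hα] at hpow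
    simpa using (ENNReal.Tendsto.const_mul hpow (Or.inr hC)).mono_left nhdsWithin_le_nhds
  refine le_antisymm (ge_of_tendsto hlim ?_) zero_le
  filter_upwards [self_mem_nhdsWithin] with r (hr : 0 < r)
  exact (measure_mono (by simpa using hr.le)).trans (hν r hr)

lemma lintegral_edist_rpow_neg_le [OpensMeasurableSpace X] {β : ℝ} (hβ : 0 < β) (hβα : β < α)
    (hC : C ≠ ∞) (x : X)
    (hν : ∀ r > 0, ν (Metric.closedBall x r) ≤ C * ENNReal.ofReal r ^ α) :
    ∫⁻ y, edist x y ^ (-β) ∂ν ≤ ENNReal.ofReal β *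
      (ν Set.univ * (∫⁻ t in Set.Ioc (0 : ℝ) 1, ENNReal.ofReal (t ^ (β - 1))) +
        C * ∫⁻ t in Set.Ioi (1 : ℝ), ENNReal.ofReal (t ^ (β - α - 1))) := by
  have hx : ν {x} = 0 := measure_singleton_eq_zero_of_closedBall_le (hβ.trans hβα) hC x hν
  have hinv : ∫⁻ y, edist x y ^ (-β) ∂ν = ∫⁻ y, ENNReal.ofReal ((dist x y)⁻¹ ^ β) ∂ν := by
    refine lintegral_congr_ae ?_
    filter_upwards [measure_eq_zero_iff_ae_notMem.1 hx] with y hy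
    have hd : 0 < dist x y := dist_pos.2 (Ne.symm hy)
    rw [edist_dist, ENNReal.ofReal_rpow_of_pos hd, Real.rpow_neg hd.le, Real.inv_rpow hd.le]
  rw [hinv, lintegral_rpow_eq_lintegral_meas_lt_mul ν (.of_forall fun y => by positivity)
    (by fun_prop) hβ, ← Set.Ioc_union_Ioi_eq_Ioi zero_le_one]
  gcongr
  refine (lintegral_union_le _ _ _).trans (add_le_add ?_ ?_)
  · rw [← lintegral_const_mul _ (by fun_prop)]
    gcongr
    exact Set.subset_univ _
  · rw [← lintegral_const_mul _ (by fun_prop)]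
    refine setLIntegral_mono (by fun_prop) fun t (ht : 1 < t) => ?_
    have ht0 : 0 < t := one_pos.trans ht
    have hball : {y | t < (dist x y)⁻¹} ⊆ Metric.closedBall x t⁻¹ := fun y hy => by
      have hd : 0 < dist x y := inv_pos.1 (ht0.trans hy)
      rw [Metric.mem_closedBall, dist_comm]
      exact ((lt_inv_comm₀ ht0 hd).1 hy).le
    calc _ ≤ C * ENNReal.ofReal t⁻¹ ^ α * ENNReal.ofReal (t ^ (β - 1)) := by
          gcongr
          exact (measure_mono hball).trans (hν t⁻¹ (inv_pos.2 ht0))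
      _ = C * ENNReal.ofReal (t ^ (β - α - 1)) := by
          rw [mul_assoc, ENNReal.ofReal_rpow_of_pos (inv_pos.2 ht0),
            ← ENNReal.ofReal_mul (by positivity), Real.inv_rpow ht0.le, ← Real.rpow_neg ht0.le,
            ← Real.rpow_add ht0]
          ring_nf

lemma lintegral_lintegral_edist_rpow_neg_lt_top [OpensMeasurableSpace X] [IsFiniteMeasure ν]
    {β : ℝ} (hβ : 0 < β) (hβα : β < α) (hC : C ≠ ∞)
    (hν : ∀ x, ∀ r > 0, ν (Metric.closedBall x r) ≤ C * ENNReal.ofReal r ^ α) :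
    ∫⁻ x, ∫⁻ y, edist x y ^ (-β) ∂ν ∂ν < ∞ := by
  refine (lintegral_mono fun x => lintegral_edist_rpow_neg_le hβ hβα hC x (hν x)).trans_lt ?_
  have hnear : ∫⁻ t in Set.Ioc (0 : ℝ) 1, ENNReal.ofReal (t ^ (β - 1)) < ∞ :=
    Integrable.lintegral_lt_top ((intervalIntegrable_iff_integrableOn_Ioc_of_le zero_le_one).1
      (intervalIntegral.intervalIntegrable_rpow' (by linarith)))
  have hfar : ∫⁻ t in Set.Ioi (1 : ℝ), ENNReal.ofReal (t ^ (β - α - 1)) < ∞ :=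
    Integrable.lintegral_lt_top (integrableOn_Ioi_rpow_of_lt (by linarith) one_pos)
  rw [lintegral_const]
  finiteness

end Energy

lemma exists_lt_dimH_inter_Ioc {A : Set ℝ} {d : ℝ≥0∞} (hd : d < dimH A) {r : ℝ} (hr : 0 < r) :
    ∃ x, d < dimH (A ∩ Set.Ioc x (x + r)) := by
  have hA : A = ⋃ n : ℤ, A ∩ Set.Ioc (n • r) ((n + 1) • r) := by
    rw [← Set.inter_iUnion, iUnion_Ioc_zsmul hr, Set.inter_univ]
  rw [hA, dimH_iUnion, lt_iSup_iff] at hd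
  obtain ⟨n, hn⟩ := hd
  exact ⟨n • r, by rwa [add_smul, one_smul] at hn⟩

/-- Restricting to a piece of small diameter is what allows one to use the separation of the
functions `φ n`, which holds only at small scales. -/
lemma exists_measure_energy_lt_top {A : Set ℝ} (hA : AnalyticSet A) {β : ℝ} (hβ : 0 < β)
    (hdim : ENNReal.ofReal β < dimH A) {r : ℝ} (hr : 0 < r) :
    ∃ K ⊆ A, IsCompact K ∧ (∀ x ∈ K, ∀ y ∈ K, dist x y ≤ r) ∧
      ∃ ν : Measure ℝ, IsFiniteMeasure ν ∧ ν ≠ 0 ∧ ν Kᶜ = 0 ∧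
        ∫⁻ x, ∫⁻ y, edist x y ^ (-β) ∂ν ∂ν < ∞ := by
  obtain ⟨α, hβα, hα⟩ := ENNReal.lt_iff_exists_nnreal_btwn.1 hdim
  rw [ENNReal.ofReal_lt_coe_iff hβ.le] at hβα
  obtain ⟨z, hz⟩ := exists_lt_dimH_inter_Ioc hα hr
  have hpiece : AnalyticSet (A ∩ Set.Ioc z (z + r)) := by
    rw [Set.inter_eq_iInter]
    exact AnalyticSet.iInter (Bool.rec measurableSet_Ioc.analyticSet hA)
  obtain ⟨K, hKA, hK, ν, hfin, hν0, hνK, C, hC, hν⟩ := exists_measure_closedBall_le_rpow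
    hpiece (by exact_mod_cast hβ.trans hβα) hz
  refine ⟨K, hKA.trans Set.inter_subset_left, hK, fun x hx y hy => ?_, ν, hfin, hν0, hνK,
    lintegral_lintegral_edist_rpow_neg_lt_top hβ hβα hC hν⟩
  have hdist := Real.dist_le_of_mem_Icc (Set.Ioc_subset_Icc_self (hKA hx).2)
    (Set.Ioc_subset_Icc_self (hKA hy).2)
  linarith

end Frostman

/-! ### The Bessel function `J₀` -/

/-- The Bessel function `J₀`, as an average over the circle. -/
noncomputable def besselZero (t : ℝ) : ℝ :=
  ∫ θ in (0 : ℝ)..1, Real.cos (t * Real.cos (2 * Real.pi * θ))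

/-- The `k`-th derivative of `J₀`, obtained by differentiating under the integral; the shift by
`k * π / 2` encodes the `k`-th derivative of the cosine. -/
noncomputable def besselZeroDeriv (k : ℕ) (t : ℝ) : ℝ :=
  ∫ θ in (0 : ℝ)..1, Real.cos (2 * Real.pi * θ) ^ k *
    Real.cos (t * Real.cos (2 * Real.pi * θ) + k * Real.pi / 2)

lemma besselZeroDeriv_zero (t : ℝ) : besselZeroDeriv 0 t = besselZero t := by
  simp [besselZeroDeriv, besselZero]

lemma hasDerivAt_besselZeroDeriv (k : ℕ) (t : ℝ) :
    HasDerivAt (besselZeroDeriv k) (besselZeroDeriv (k + 1) t) t := by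
  refine (intervalIntegral.hasDerivAt_integral_of_dominated_loc_of_deriv_le (s := Set.univ)
    (bound := fun _ => 1)
    (F := fun t θ => Real.cos (2 * Real.pi * θ) ^ k *
      Real.cos (t * Real.cos (2 * Real.pi * θ) + k * Real.pi / 2))
    (F' := fun t θ => Real.cos (2 * Real.pi * θ) ^ (k + 1) *
      Real.cos (t * Real.cos (2 * Real.pi * θ) + (k + 1 : ℕ) * Real.pi / 2))
    univ_mem ?_ ?_ ?_ ?_ ?_ ?_).2
  · exact Eventually.of_forall fun s => Continuous.aestronglyMeasurable (by fun_prop)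
  · exact Continuous.intervalIntegrable (by fun_prop) _ _
  · exact Continuous.aestronglyMeasurable (by fun_prop)
  · refine Eventually.of_forall fun θ _ s _ => ?_
    rw [norm_mul, norm_pow]
    exact mul_le_one₀ (pow_le_one₀ (norm_nonneg _) (Real.abs_cos_le_one _)) (norm_nonneg _)
      (Real.abs_cos_le_one _)
  · exact continuous_const.intervalIntegrable _ _
  · refine Eventually.of_forall fun θ _ s _ => ?_
    have h := ((((hasDerivAt_id s).mul_const (Real.cos (2 * Real.pi * θ))).add_const
      (k * Real.pi / 2)).cos).const_mul (Real.cos (2 * Real.pi * θ) ^ k)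
    refine h.congr_deriv ?_
    rw [show s * Real.cos (2 * Real.pi * θ) + ((k + 1 : ℕ) : ℝ) * Real.pi / 2 =
      s * Real.cos (2 * Real.pi * θ) + k * Real.pi / 2 + Real.pi / 2 by push_cast; ring,
      Real.cos_add_pi_div_two]
    simp only [id]
    ring

lemma besselZero_ode (t : ℝ) :
    t * besselZeroDeriv 2 t + besselZeroDeriv 1 t + t * besselZeroDeriv 0 t = 0 := by
  have hderiv (θ : ℝ) : HasDerivAt (fun θ => -(2 * Real.pi)⁻¹ *
      (Real.sin (2 * Real.pi * θ) * Real.sin (t * Real.cos (2 * Real.pi * θ))))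
      (t * (Real.cos (2 * Real.pi * θ) ^ 2 *
          Real.cos (t * Real.cos (2 * Real.pi * θ) + (2 : ℕ) * Real.pi / 2)) +
        Real.cos (2 * Real.pi * θ) ^ 1 *
          Real.cos (t * Real.cos (2 * Real.pi * θ) + (1 : ℕ) * Real.pi / 2) +
        t * (Real.cos (2 * Real.pi * θ) ^ 0 *
          Real.cos (t * Real.cos (2 * Real.pi * θ) + (0 : ℕ) * Real.pi / 2))) θ := by
    have h0 : HasDerivAt (fun θ : ℝ => 2 * Real.pi * θ) (2 * Real.pi) θ := by
      simpa using (hasDerivAt_id θ).const_mul (2 * Real.pi)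
    refine ((h0.sin.mul (h0.cos.const_mul t).sin).const_mul (-(2 * Real.pi)⁻¹)).congr_deriv ?_
    have hpi := Real.pi_ne_zero
    simp only [Nat.cast_ofNat, Nat.cast_one, Nat.cast_zero, one_mul, zero_mul, zero_div, add_zero,
      mul_div_cancel_left₀ _ (two_ne_zero' ℝ), Real.cos_add_pi, Real.cos_add_pi_div_two, pow_one,
      pow_zero, Real.cos_sq' (2 * Real.pi * θ)]
    field_simp
    ring
  have key := intervalIntegral.integral_eq_sub_of_hasDerivAt (a := 0) (b := 1)
    (fun θ _ => hderiv θ) (Continuous.intervalIntegrable (by fun_prop) _ _)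
  rw [intervalIntegral.integral_add (Continuous.intervalIntegrable (by fun_prop) _ _)
    (Continuous.intervalIntegrable (by fun_prop) _ _),
    intervalIntegral.integral_add (Continuous.intervalIntegrable (by fun_prop) _ _)
    (Continuous.intervalIntegrable (by fun_prop) _ _), intervalIntegral.integral_const_mul,
    intervalIntegral.integral_const_mul] at key
  simpa [besselZeroDeriv] using key

/-- A modified energy of Bessel's equation: the two correction terms make it nonincreasing while
keeping it above `t * J₀(t) ^ 2`. -/
noncomputable def besselEnergy (t : ℝ) : ℝ :=
  t * (besselZeroDeriv 0 t ^ 2 + besselZeroDeriv 1 t ^ 2) +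
    besselZeroDeriv 0 t * besselZeroDeriv 1 t + besselZeroDeriv 0 t ^ 2 / (2 * t)

lemma hasDerivAt_besselEnergy {t : ℝ} (ht : t ≠ 0) :
    HasDerivAt besselEnergy (-(besselZeroDeriv 0 t ^ 2 / (2 * t ^ 2))) t := by
  have h0 := hasDerivAt_besselZeroDeriv 0 t
  have h1 := hasDerivAt_besselZeroDeriv 1 t
  refine ((((hasDerivAt_id t).mul ((h0.pow 2).add (h1.pow 2))).add (h0.mul h1)).add
    ((h0.pow 2).div ((hasDerivAt_id t).const_mul 2) (by simpa using ht))).congr_deriv ?_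
  have hode : besselZeroDeriv 1 t = -(t * (besselZeroDeriv 0 t + besselZeroDeriv 2 t)) := by
    linear_combination besselZero_ode t
  simp only [id, Pi.add_apply, Pi.pow_apply, zero_add, one_add_one_eq_two, hode]
  field_simp
  ring

lemma mul_besselZero_sq_le_besselEnergy {t : ℝ} (ht : 0 < t) :
    t * besselZero t ^ 2 ≤ besselEnergy t := by
  have h : besselEnergy t = t * besselZero t ^ 2 +
      ((t * besselZeroDeriv 1 t + besselZero t / 2) ^ 2 + besselZero t ^ 2 / 4) / t := by
    rw [besselEnergy, besselZeroDeriv_zero]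
    field_simp
    ring
  rw [h]
  exact le_add_of_nonneg_right (by positivity)

lemma besselZero_sq_le_div {t : ℝ} (ht : 1 ≤ t) : besselZero t ^ 2 ≤ besselEnergy 1 / t := by
  have hanti : AntitoneOn besselEnergy (Set.Ici 1) := by
    have hpos {s : ℝ} (hs : s ∈ Set.Ici 1) : s ≠ 0 := (zero_lt_one.trans_le hs).ne'
    refine antitoneOn_of_hasDerivWithinAt_nonpos (convex_Ici 1)
      (fun s hs => (hasDerivAt_besselEnergy (hpos hs)).continuousAt.continuousWithinAt)
      (fun s hs => (hasDerivAt_besselEnergy (hpos (interior_subset hs))).hasDerivWithinAt)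
      fun s _ => neg_nonpos.2 (by positivity)
  rw [le_div_iff₀' (by linarith)]
  exact (mul_besselZero_sq_le_besselEnergy (by linarith)).trans (hanti Set.self_mem_Ici ht ht)

lemma besselZero_sq_le_besselZero_two_mul (t : ℝ) :
    besselZero t ^ 2 ≤ (1 + besselZero (2 * t)) / 2 := by
  set J := besselZero t with hJ
  have hvar : 0 ≤ ∫ θ in (0 : ℝ)..1, (Real.cos (t * Real.cos (2 * Real.pi * θ)) - J) ^ 2 :=
    intervalIntegral.integral_nonneg zero_le_one fun _ _ => sq_nonneg _
  have hexpand (θ : ℝ) : (Real.cos (t * Real.cos (2 * Real.pi * θ)) - J) ^ 2 =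
      (1 / 2 + J ^ 2) + (1 / 2) * Real.cos (2 * t * Real.cos (2 * Real.pi * θ)) -
        2 * J * Real.cos (t * Real.cos (2 * Real.pi * θ)) := by
    rw [mul_assoc 2 t, Real.cos_two_mul]
    ring
  simp only [hexpand] at hvar
  rw [intervalIntegral.integral_sub (Continuous.intervalIntegrable (by fun_prop) _ _)
    (Continuous.intervalIntegrable (by fun_prop) _ _), intervalIntegral.integral_add
    (Continuous.intervalIntegrable (by fun_prop) _ _)
    (Continuous.intervalIntegrable (by fun_prop) _ _), intervalIntegral.integral_const_mul,
    intervalIntegral.integral_const_mul, intervalIntegral.integral_const, ← besselZero,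
    ← besselZero, ← hJ, sub_zero, one_smul] at hvar
  linarith

section Doubling

variable {f : ℝ → ℝ}

lemma exists_abs_le_one_sub_mul_sq (hdouble : ∀ t, f t ^ 2 ≤ (1 + f (2 * t)) / 2) {T : ℝ}
    (hT : 1 ≤ T) (hf : ∀ t ≥ T, |f t| ≤ 1 / 2) :
    ∃ c > 0, ∀ t, 0 < t → t ≤ 2 * T → |f t| ≤ 1 - c * t ^ 2 := by
  have : 0 < T := zero_lt_one.trans_le hT
  refine ⟨1 / (8 * T ^ 2), by positivity, ?_⟩
  set c := 1 / (8 * T ^ 2) with hc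
  have hbase {t : ℝ} (h1 : T ≤ t) (h2 : t ≤ 2 * T) : |f t| ≤ 1 - c * t ^ 2 := by
    have : c * t ^ 2 ≤ c * (2 * T) ^ 2 := by gcongr; linarith
    have hcT : c * (2 * T) ^ 2 = 1 / 2 := by rw [hc]; field_simp; norm_num
    linarith [hf t h1]
  have hstep {t : ℝ} (ht : 0 < t) (htT : t ≤ T) (h : |f (2 * t)| ≤ 1 - c * (2 * t) ^ 2) :
      |f t| ≤ 1 - c * t ^ 2 := by
    have hct : c * t ^ 2 ≤ c * T ^ 2 := by gcongr
    have hcT : c * T ^ 2 = 1 / 8 := by rw [hc]; field_simp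
    refine abs_le_of_sq_le_sq ?_ (by linarith)
    nlinarith [hdouble t, le_abs_self (f (2 * t)), sq_nonneg (c * t ^ 2)]
  have hind (n : ℕ) : ∀ t, T / 2 ^ n ≤ t → t ≤ 2 * T → |f t| ≤ 1 - c * t ^ 2 := by
    induction n with
    | zero => exact fun t h1 h2 => hbase (by simpa using h1) h2
    | succ n ih =>
      intro t h1 h2
      rcases le_total T t with h | h
      · exact hbase h h2
      · refine hstep (lt_of_lt_of_le (by positivity) h1) h (ih _ ?_ (by linarith))
        rw [pow_succ, ← div_div, div_le_iff₀ two_pos] at h1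
        linarith
  intro t ht htT
  obtain ⟨n, hn⟩ := pow_unbounded_of_one_lt (T / t) (one_lt_two : (1 : ℝ) < 2)
  exact hind n t ((div_lt_comm₀ ht (by positivity)).1 hn).le htT

lemma one_sub_mul_sq_le_rpow {c : ℝ} (hc : 0 ≤ c) (t : ℝ) : 1 - c * t ^ 2 ≤ (1 + t ^ 2) ^ (-c) := by
  calc 1 - c * t ^ 2 ≤ Real.exp (-(c * t ^ 2)) := by
        linarith [Real.add_one_le_exp (-(c * t ^ 2))]
    _ = Real.exp (t ^ 2) ^ (-c) := by rw [← Real.exp_mul]; ring_nf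
    _ ≤ (1 + t ^ 2) ^ (-c) :=
        Real.rpow_le_rpow_of_nonpos (by positivity) (by linarith [Real.add_one_le_exp (t ^ 2)])
          (neg_nonpos.2 hc)

lemma abs_le_rpow_of_sq_le_div {C t : ℝ} (hf : f t ^ 2 ≤ C / t) (ht : 2 ≤ t)
    (hC : C ^ 2 ≤ t) : |f t| ≤ (1 + t ^ 2) ^ (-(1 / 12) : ℝ) := by
  have ht0 : 0 < t := by linarith
  refine abs_le_of_sq_le_sq (hf.trans ?_) (by positivity)
  calc C / t ≤ Real.sqrt t / t := by gcongr; exact Real.le_sqrt_of_sq_le hC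
    _ = (t ^ 3) ^ (-(1 / 6) : ℝ) := by
      rw [Real.sqrt_div_self, one_div, Real.sqrt_eq_rpow, ← Real.rpow_neg ht0.le,
        ← Real.rpow_natCast, ← Real.rpow_mul ht0.le]
      norm_num
    _ ≤ (1 + t ^ 2) ^ (-(1 / 6) : ℝ) :=
      Real.rpow_le_rpow_of_nonpos (by positivity) (by nlinarith) (by norm_num)
    _ = ((1 + t ^ 2) ^ (-(1 / 12) : ℝ)) ^ 2 := by
      rw [← Real.rpow_mul_natCast (by positivity)]
      norm_num

theorem exists_abs_le_rpow_of_doubling (hdouble : ∀ t, f t ^ 2 ≤ (1 + f (2 * t)) / 2) {C : ℝ}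
    (hdecay : ∀ t ≥ 1, f t ^ 2 ≤ C / t) :
    ∃ κ > (0 : ℝ), ∀ t, 0 ≤ t → |f t| ≤ (1 + t ^ 2) ^ (-κ) := by
  have hC : 0 ≤ C := by simpa using (sq_nonneg _).trans (hdecay 1 le_rfl)
  set T := 2 + 4 * C + C ^ 2 with hT
  have hT2 : 2 ≤ T := by nlinarith [hT]
  have hhalf (t : ℝ) (ht : T ≤ t) : |f t| ≤ 1 / 2 := by
    refine abs_le_of_sq_le_sq ((hdecay t (by linarith)).trans ?_) (by norm_num)
    rw [div_le_iff₀ (by linarith)]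
    nlinarith [hT]
  obtain ⟨c, hc, hsmall⟩ := exists_abs_le_one_sub_mul_sq hdouble (by linarith) hhalf
  refine ⟨min c (1 / 12), by positivity, fun t ht => ?_⟩
  have hexp {κ : ℝ} (hκ : min c (1 / 12) ≤ κ) :
      (1 + t ^ 2) ^ (-κ) ≤ (1 + t ^ 2) ^ (-min c (1 / 12)) :=
    Real.rpow_le_rpow_of_exponent_le (by nlinarith) (neg_le_neg hκ)
  rcases ht.eq_or_lt with rfl | ht0
  · have := hdouble 0
    rw [mul_zero] at this
    have h0 : |f 0| ≤ 1 := abs_le.2 ⟨by nlinarith, by nlinarith⟩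
    simpa using h0
  rcases le_total t (2 * T) with h | h
  · exact (hsmall t ht0 h).trans ((one_sub_mul_sq_le_rpow hc.le t).trans (hexp (min_le_left _ _)))
  · refine (abs_le_rpow_of_sq_le_div (hdecay t ?_) ?_ ?_).trans (hexp (min_le_right _ _)) <;>
      nlinarith

end Doubling

theorem exists_abs_besselZero_le_rpow :
    ∃ κ > (0 : ℝ), ∀ t, 0 ≤ t → |besselZero t| ≤ (1 + t ^ 2) ^ (-κ) :=
  exists_abs_le_rpow_of_doubling besselZero_sq_le_besselZero_two_mul
    fun _ => besselZero_sq_le_div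

/-! ### Characteristic functions of series with random phases -/

lemma measureFourier_eq_charFun (μ : Measure ℂ) (ξ : ℂ) :
    measureFourier μ ξ = charFun μ (-(2 * Real.pi) • ξ) := by
  simp only [measureFourier, charFun_apply, real_inner_smul_right, real_inner_comm ξ]
  push_cast
  ring_nf

section CircleAverage

open scoped ComplexConjugate

lemma inner_mul_exp_two_pi (w t : ℂ) (θ : ℝ) :
    inner ℝ (w * Complex.exp (2 * Real.pi * Complex.I * θ)) t =
      ‖t‖ * ‖w‖ * Real.cos (2 * Real.pi * (θ + Complex.arg (conj t * w) / (2 * Real.pi))) := by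
  set z := conj t * w with hz
  have hpi : (Real.pi : ℂ) ≠ 0 := Complex.ofReal_ne_zero.2 Real.pi_ne_zero
  have hnorm : ‖t‖ * ‖w‖ = ‖z‖ := by rw [hz, norm_mul, Complex.norm_conj]
  calc inner ℝ (w * Complex.exp (2 * Real.pi * Complex.I * θ)) t
      = (z * Complex.exp (2 * Real.pi * Complex.I * θ)).re := by
        rw [real_inner_comm, Complex.inner, hz]
        ring_nf
    _ = ((‖z‖ : ℂ) * Complex.exp (((2 * Real.pi * (θ + Complex.arg z / (2 * Real.pi)) : ℝ) : ℂ) *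
          Complex.I)).re := by
        conv_lhs => rw [← Complex.norm_mul_exp_arg_mul_I z, mul_assoc, ← Complex.exp_add]
        congr 3
        push_cast
        field_simp
        ring
    _ = _ := by rw [Complex.re_ofReal_mul, Complex.exp_ofReal_mul_I_re, hnorm]

lemma integral_sin_mul_cos_two_pi (t : ℝ) :
    ∫ θ in (0 : ℝ)..1, Real.sin (t * Real.cos (2 * Real.pi * θ)) = 0 := by
  set f : ℝ → ℝ := fun θ => Real.sin (t * Real.cos (2 * Real.pi * θ)) with hf
  have hper : Function.Periodic f 1 := fun θ => by
    simp only [hf, mul_add, mul_one, Real.cos_add_two_pi]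
  have hanti (θ : ℝ) : f (θ + 1 / 2) = -f θ := by
    simp only [hf]
    rw [show 2 * Real.pi * (θ + 1 / 2) = 2 * Real.pi * θ + Real.pi by ring, Real.cos_add_pi,
      mul_neg, Real.sin_neg]
  have hshift : ∫ θ in (0 : ℝ)..1, f (θ + 1 / 2) = ∫ θ in (0 : ℝ)..1, f θ := by
    rw [intervalIntegral.integral_comp_add_right, add_comm 1, zero_add]
    simpa using hper.intervalIntegral_add_eq (1 / 2) 0
  simp only [hanti, intervalIntegral.integral_neg] at hshift
  linarith

lemma integral_exp_mul_cos_two_pi (t : ℝ) :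
    ∫ θ in (0 : ℝ)..1, Complex.exp ((t * Real.cos (2 * Real.pi * θ) : ℝ) * Complex.I) =
      besselZero t := by
  simp only [Complex.exp_mul_I, ← Complex.ofReal_cos, ← Complex.ofReal_sin]
  rw [intervalIntegral.integral_add (Continuous.intervalIntegrable (by fun_prop) _ _)
    (Continuous.intervalIntegrable (by fun_prop) _ _), intervalIntegral.integral_mul_const,
    intervalIntegral.integral_ofReal, intervalIntegral.integral_ofReal,
    integral_sin_mul_cos_two_pi]
  simp [besselZero]

lemma integral_exp_inner_circle (w t : ℂ) :
    ∫ θ in (0 : ℝ)..1, Complex.exp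
        ((inner ℝ (w * Complex.exp (2 * Real.pi * Complex.I * θ)) t : ℝ) * Complex.I) =
      besselZero (‖t‖ * ‖w‖) := by
  set g : ℝ → ℂ := fun θ =>
    Complex.exp ((‖t‖ * ‖w‖ * Real.cos (2 * Real.pi * θ) : ℝ) * Complex.I) with hg
  have hper : Function.Periodic g 1 := fun θ => by
    simp only [hg, mul_add, mul_one, Real.cos_add_two_pi]
  simp only [inner_mul_exp_two_pi]
  rw [intervalIntegral.integral_comp_add_right g, zero_add, add_comm 1,
    hper.intervalIntegral_add_eq _ 0, zero_add, integral_exp_mul_cos_two_pi]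

end CircleAverage

lemma charFun_map_eq_integral {Ω E : Type*} [MeasurableSpace Ω] {P : Measure Ω}
    [NormedAddCommGroup E] [InnerProductSpace ℝ E] [MeasurableSpace E] [BorelSpace E]
    [SecondCountableTopology E] {X : Ω → E} (hX : AEMeasurable X P) (t : E) :
    charFun (P.map X) t = ∫ ω, Complex.exp ((inner ℝ (X ω) t : ℝ) * Complex.I) ∂P := by
  rw [charFun_apply, integral_map hX (by fun_prop)]

lemma tendsto_charFun_map {Ω E ι : Type*} {l : Filter ι} [l.IsCountablyGenerated]
    [MeasurableSpace Ω] {P : Measure Ω} [IsFiniteMeasure P] [NormedAddCommGroup E]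
    [InnerProductSpace ℝ E] [MeasurableSpace E] [BorelSpace E] [SecondCountableTopology E]
    {X : ι → Ω → E} {Y : Ω → E} (hX : ∀ i, AEMeasurable (X i) P) (hY : AEMeasurable Y P)
    (hlim : ∀ᵐ ω ∂P, Tendsto (fun i => X i ω) l (nhds (Y ω))) (t : E) :
    Tendsto (fun i => charFun (P.map (X i)) t) l (nhds (charFun (P.map Y) t)) := by
  have hcont : Continuous fun x : E => Complex.exp ((inner ℝ x t : ℝ) * Complex.I) := by fun_prop
  simp only [charFun_map_eq_integral (hX _), charFun_map_eq_integral hY]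
  refine tendsto_integral_filter_of_dominated_convergence (fun _ => 1)
    (Eventually.of_forall fun i => hcont.comp_aestronglyMeasurable (hX i).aestronglyMeasurable)
    (Eventually.of_forall fun i => Eventually.of_forall fun ω =>
      (Complex.norm_exp_ofReal_mul_I _).le) (integrable_const _) ?_
  filter_upwards [hlim] with ω hω using (hcont.tendsto _).comp hω

section RandomPhases

variable {Ω ι : Type*} [MeasurableSpace Ω] {P : Measure Ω}

lemma integral_comp_of_isUniform {E : Type*} [NormedAddCommGroup E] [NormedSpace ℝ E] {X : Ω → ℝ}
    (hX : AEMeasurable X P) (hunif : pdf.IsUniform X (Set.Icc 0 1) P volume) {g : ℝ → E}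
    (hg : Continuous g) : ∫ ω, g (X ω) ∂P = ∫ θ in (0 : ℝ)..1, g θ := by
  have hlaw : P.map X = volume.restrict (Set.Ioc 0 1) := by
    rw [hunif, ProbabilityTheory.cond, restrict_Ioc_eq_restrict_Icc]
    simp
  rw [← integral_map hX hg.aestronglyMeasurable, hlaw, intervalIntegral.integral_of_le zero_le_one]

lemma charFun_map_mul_exp {X : Ω → ℝ} (hX : AEMeasurable X P)
    (hunif : pdf.IsUniform X (Set.Icc 0 1) P volume) (w t : ℂ) :
    charFun (P.map fun ω => w * Complex.exp (2 * Real.pi * Complex.I * X ω)) t =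
      besselZero (‖t‖ * ‖w‖) := by
  rw [charFun_map_eq_integral (by fun_prop), integral_comp_of_isUniform hX hunif
    (g := fun θ => Complex.exp
      ((inner ℝ (w * Complex.exp (2 * Real.pi * Complex.I * θ)) t : ℝ) * Complex.I)) (by fun_prop),
    integral_exp_inner_circle]

lemma norm_exp_two_pi_I_mul (θ : ℝ) : ‖Complex.exp (2 * Real.pi * Complex.I * θ)‖ = 1 := by
  rw [show 2 * Real.pi * Complex.I * θ = (2 * Real.pi * θ : ℝ) * Complex.I by push_cast; ring,
    Complex.norm_exp_ofReal_mul_I]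

variable {θ : ι → Ω → ℝ} {w : ι → ℂ}

theorem norm_charFun_map_tsum_le [Countable ι] (hθ : ∀ i, Measurable (θ i)) (hind : iIndepFun θ P)
    (hunif : ∀ i, pdf.IsUniform (θ i) (Set.Icc 0 1) P volume) (hw : Summable fun i => ‖w i‖)
    (F : Finset ι) (t : ℂ) :
    ‖charFun (P.map fun ω => ∑' i, w i * Complex.exp (2 * Real.pi * Complex.I * θ i ω)) t‖ ≤
      ∏ i ∈ F, |besselZero (‖t‖ * ‖w i‖)| := by
  have := hind.isProbabilityMeasure
  let X (i : ι) (ω : Ω) : ℂ := w i * Complex.exp (2 * Real.pi * Complex.I * θ i ω)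
  have hXm (i : ι) : Measurable (X i) := by fun_prop
  have hXind : iIndepFun X P :=
    hind.comp (fun i θ => w i * Complex.exp (2 * Real.pi * Complex.I * θ)) fun i => by fun_prop
  have hfac (i : ι) : charFun (P.map (X i)) t = besselZero (‖t‖ * ‖w i‖) :=
    charFun_map_mul_exp (hθ i).aemeasurable (hunif i) _ _
  have hprod (s : Finset ι) : ‖charFun (P.map fun ω => ∑ i ∈ s, X i ω) t‖ =
      ∏ i ∈ s, |besselZero (‖t‖ * ‖w i‖)| := by
    rw [(hXind.restrict s).charFun_map_fun_finsetSum_eq_prod fun i _ => (hXm i).aemeasurable,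
      Finset.prod_apply, norm_prod]
    simp only [hfac, Complex.norm_real, Real.norm_eq_abs]
  have hsum (ω : Ω) : Tendsto (fun s => ∑ i ∈ s, X i ω) atTop (nhds (∑' i, X i ω)) :=
    (Summable.of_norm (by simpa [X, norm_exp_two_pi_I_mul] using hw)).hasSum
  have hYm : Measurable fun ω => ∑' i, X i ω :=
    measurable_of_tendsto_metrizable' atTop (fun s => Finset.measurable_sum s fun i _ => hXm i)
      (tendsto_pi_nhds.2 fun ω => by simpa using hsum ω)
  have hlim := tendsto_charFun_map (P := P) (l := (atTop : Filter (Finset ι)))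
    (fun s => (Finset.measurable_fun_sum s fun i _ => hXm i).aemeasurable) hYm.aemeasurable
    (Eventually.of_forall hsum) t
  refine le_of_tendsto hlim.norm ?_
  filter_upwards [eventually_ge_atTop F] with s hs
  rw [hprod]
  refine Finset.prod_le_prod_of_subset_of_le_one hs (fun _ _ => abs_nonneg _) fun i _ _ => ?_
  rw [← Real.norm_eq_abs, ← Complex.norm_real, ← hfac]
  have := Measure.isProbabilityMeasure_map (μ := P) (hXm i).aemeasurable
  exact norm_charFun_le_one _

end RandomPhases

/-! ### Energies of random image measures -/

section Radial

variable {E : Type*} [NormedAddCommGroup E] [NormedSpace ℝ E] [FiniteDimensional ℝ E]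
  [MeasurableSpace E] [BorelSpace E] (μ : Measure E) [μ.IsAddHaarMeasure]

lemma integrableOn_rpow_mul_one_add_sq_rpow {s N : ℝ} (hs : 0 < s) (hN : s < 2 * N) :
    IntegrableOn (fun y : ℝ => y ^ (s - 1) * (1 + y ^ 2) ^ (-N)) (Set.Ioi 0) := by
  have hm : AEStronglyMeasurable (fun y : ℝ => y ^ (s - 1) * (1 + y ^ 2) ^ (-N)) := by fun_prop
  rw [← Set.Ioo_union_Ici_eq_Ioi zero_lt_one]
  refine IntegrableOn.union ?_ ((integrableOn_Ici_iff_integrableOn_Ioi).2 ?_)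
  · refine Integrable.mono' ((intervalIntegral.integrableOn_Ioo_rpow_iff one_pos).2
      (by linarith : -1 < s - 1)) hm.restrict ?_
    filter_upwards [ae_restrict_mem measurableSet_Ioo] with y ⟨hy, _⟩
    rw [Real.norm_of_nonneg (by positivity)]
    exact mul_le_of_le_one_right (by positivity)
      (Real.rpow_le_one_of_one_le_of_nonpos (by nlinarith) (by linarith))
  · refine Integrable.mono' (integrableOn_Ioi_rpow_of_lt
      (by linarith : s - 1 + 2 * -N < -1) one_pos) hm.restrict ?_
    filter_upwards [ae_restrict_mem measurableSet_Ioi] with y hy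
    have hy0 : 0 < y := zero_lt_one.trans hy
    rw [Real.norm_of_nonneg (by positivity), Real.rpow_add hy0, Real.rpow_mul hy0.le,
      Real.rpow_ofNat]
    exact mul_le_mul_of_nonneg_left (Real.rpow_le_rpow_of_nonpos (by positivity) (by linarith)
      (by linarith)) (by positivity)

lemma lintegral_norm_rpow_mul_one_add_sq_rpow_lt_top [Nontrivial E] {s N : ℝ} (hs : 0 < s)
    (hN : s < 2 * N) :
    ∫⁻ ξ : E, ENNReal.ofReal
      (‖ξ‖ ^ (s - Module.finrank ℝ E) * (1 + ‖ξ‖ ^ 2) ^ (-N)) ∂μ < ∞ := by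
  refine Integrable.lintegral_lt_top ((integrable_fun_norm_addHaar μ (f := fun y =>
    y ^ (s - Module.finrank ℝ E) * (1 + y ^ 2) ^ (-N))).2 ?_)
  refine (integrableOn_rpow_mul_one_add_sq_rpow hs hN).congr_fun (fun y hy => ?_)
    measurableSet_Ioi
  have hdim : 1 ≤ Module.finrank ℝ E := Module.finrank_pos
  simp only [smul_eq_mul]
  rw [← mul_assoc, ← Real.rpow_natCast _ (_ - 1), ← Real.rpow_add hy, Nat.cast_sub hdim,
    Nat.cast_one, sub_add_sub_cancel']

lemma lintegral_norm_rpow_mul_one_add_mul_sq_rpow {s N R : ℝ} (hR : 0 < R) :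
    ∫⁻ ξ : E, ENNReal.ofReal
        (‖ξ‖ ^ (s - Module.finrank ℝ E) * (1 + (R * ‖ξ‖) ^ 2) ^ (-N)) ∂μ =
      ENNReal.ofReal (R ^ (-s)) * ∫⁻ ξ : E, ENNReal.ofReal
        (‖ξ‖ ^ (s - Module.finrank ℝ E) * (1 + ‖ξ‖ ^ 2) ^ (-N)) ∂μ := by
  set d := Module.finrank ℝ E
  let f (ξ : E) : ℝ≥0∞ := ENNReal.ofReal (‖ξ‖ ^ (s - d) * (1 + ‖ξ‖ ^ 2) ^ (-N))
  have hf : Measurable f := by fun_prop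
  have hscale (ξ : E) : ENNReal.ofReal (‖ξ‖ ^ (s - d) * (1 + (R * ‖ξ‖) ^ 2) ^ (-N)) =
      ENNReal.ofReal (R ^ (d - s)) * f (R • ξ) := by
    rw [← ENNReal.ofReal_mul (by positivity), norm_smul, Real.norm_of_nonneg hR.le,
      Real.mul_rpow hR.le (norm_nonneg _), ← mul_assoc, ← mul_assoc, ← Real.rpow_add hR,
      sub_add_sub_cancel', sub_self, Real.rpow_zero, one_mul]
  have hsubst : ∫⁻ ξ, f (R • ξ) ∂μ = ENNReal.ofReal (R ^ (-d : ℝ)) * ∫⁻ ξ, f ξ ∂μ := by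
    rw [← lintegral_map hf (measurable_const_smul R), Measure.map_addHaar_smul μ hR.ne',
      lintegral_smul_measure, smul_eq_mul, abs_of_pos (by positivity), Real.rpow_neg hR.le,
      Real.rpow_natCast]
  simp only [hscale]
  rw [lintegral_const_mul' _ _ ENNReal.ofReal_ne_top, hsubst, ← mul_assoc,
    ← ENNReal.ofReal_mul (by positivity), ← Real.rpow_add hR,
    show (d - s + -d : ℝ) = -s by ring]

end Radial

section SecondMoment

variable {Ω X E : Type*} [MeasurableSpace Ω] [MeasurableSpace X] [NormedAddCommGroup E]
  [InnerProductSpace ℝ E] [MeasurableSpace E] [BorelSpace E] [SecondCountableTopology E]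

lemma measurable_charFun_map {P : Measure Ω} [SFinite P] {S : X → Ω → E}
    (hS : Measurable (Function.uncurry S)) :
    Measurable fun z : X × E => charFun (P.map (S z.1)) z.2 := by
  have hSx (x : X) : AEMeasurable (S x) P := (hS.comp measurable_prodMk_left).aemeasurable
  have : Measurable fun z : (X × E) × Ω => inner ℝ (S z.1.1 z.2) z.1.2 :=
    (hS.comp (by fun_prop : Measurable fun z : (X × E) × Ω => (z.1.1, z.2))).inner (by fun_prop)
  simp only [charFun_map_eq_integral (hSx _)]
  have hexp : Measurable fun z : (X × E) × Ω =>
      Complex.exp (inner ℝ (S z.1.1 z.2) z.1.2 * Complex.I) := by fun_prop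
  exact hexp.stronglyMeasurable.integral_prod_right'.measurable

lemma norm_charFun_map_sq {ν : Measure X} [SFinite ν] {f : X → E} (hf : AEMeasurable f ν) (t : E) :
    ((‖charFun (ν.map f) t‖ ^ 2 : ℝ) : ℂ) =
      ∫ p, Complex.exp (inner ℝ (f p.1 - f p.2) t * Complex.I) ∂(ν.prod ν) := by
  rw [← Complex.normSq_eq_norm_sq, ← Complex.mul_conj, ← charFun_neg, charFun_map_eq_integral hf,
    charFun_map_eq_integral hf, ← integral_prod_mul]
  simp only [← Complex.exp_add, ← add_mul, ← Complex.ofReal_add, inner_neg_right, ← sub_eq_add_neg,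
    ← inner_sub_left]

lemma lintegral_enorm_charFun_map_sq_le {P : Measure Ω} [IsFiniteMeasure P] {ν : Measure X}
    [IsFiniteMeasure ν] {S : Ω → X → E} (hS : Measurable (Function.uncurry S)) (t : E) :
    ∫⁻ ω, ‖charFun (ν.map (S ω)) t‖ₑ ^ 2 ∂P ≤
      ∫⁻ p, ‖charFun (P.map fun ω => S ω p.1 - S ω p.2) t‖ₑ ∂(ν.prod ν) := by
  let g (ω : Ω) (p : X × X) : ℂ := Complex.exp (inner ℝ (S ω p.1 - S ω p.2) t * Complex.I)
  have hSω (ω : Ω) : Measurable (S ω) := hS.comp measurable_prodMk_left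
  have hdiff : Measurable fun z : Ω × X × X => S z.1 z.2.1 - S z.1 z.2.2 :=
    (hS.comp (by fun_prop : Measurable fun z : Ω × X × X => (z.1, z.2.1))).sub
      (hS.comp (by fun_prop : Measurable fun z : Ω × X × X => (z.1, z.2.2)))
  have hsq (ω : Ω) : ((‖charFun (ν.map (S ω)) t‖ ^ 2 : ℝ) : ℂ) = ∫ p, g ω p ∂(ν.prod ν) :=
    norm_charFun_map_sq (hSω ω).aemeasurable t
  have hg : Integrable (Function.uncurry g) (P.prod (ν.prod ν)) := by
    refine Integrable.of_bound (Measurable.aestronglyMeasurable ?_) 1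
      (Eventually.of_forall fun z => (Complex.norm_exp_ofReal_mul_I _).le)
    fun_prop
  calc ∫⁻ ω, ‖charFun (ν.map (S ω)) t‖ₑ ^ 2 ∂P
      = ∫⁻ ω, ENNReal.ofReal (‖charFun (ν.map (S ω)) t‖ ^ 2) ∂P := by
        simp only [ENNReal.ofReal_pow (norm_nonneg _), ofReal_norm]
    _ = ENNReal.ofReal (∫ ω, ‖charFun (ν.map (S ω)) t‖ ^ 2 ∂P) := by
        refine (ofReal_integral_eq_lintegral_ofReal ?_ (Eventually.of_forall fun ω => by
          positivity)).symm
        simpa only [Function.uncurry_apply_pair, ← hsq, RCLike.re_to_complex, Complex.ofReal_re]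
          using hg.integral_prod_left.re
    _ = ‖∫ ω, ∫ p, g ω p ∂(ν.prod ν) ∂P‖ₑ := by
        simp only [← hsq]
        rw [integral_complex_ofReal, ← ofReal_norm, Complex.norm_of_nonneg (by positivity)]
    _ = ‖∫ p, charFun (P.map fun ω => S ω p.1 - S ω p.2) t ∂(ν.prod ν)‖ₑ := by
        rw [integral_integral_swap hg]
        congr 2 with p
        exact (charFun_map_eq_integral (hdiff.comp measurable_prodMk_right).aemeasurable t).symm
    _ ≤ _ := enorm_integral_le_lintegral_enorm _

end SecondMoment

section SobolevEnergy

variable {Ω X : Type*} [MeasurableSpace Ω]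

lemma sobolevEnergy_eq_lintegral_charFun (μ : Measure ℂ) (s : ℝ) :
    sobolevEnergy μ s = ∫⁻ ξ : ℂ,
      ENNReal.ofReal (‖ξ‖ ^ (s - 2)) * ‖charFun μ (-(2 * Real.pi) • ξ)‖ₑ ^ 2 := by
  refine lintegral_congr fun ξ => ?_
  rw [measureFourier_eq_charFun, mul_comm, ENNReal.ofReal_mul (by positivity),
    ENNReal.ofReal_pow (norm_nonneg _), ofReal_norm]

lemma lintegral_sobolevEnergy_map_le [MeasurableSpace X] {P : Measure Ω} [IsFiniteMeasure P]
    {ν : Measure X} [IsFiniteMeasure ν] {S : Ω → X → ℂ} (hS : Measurable (Function.uncurry S))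
    (s : ℝ) :
    ∫⁻ ω, sobolevEnergy (ν.map (S ω)) s ∂P ≤
      ∫⁻ p : X × X, (∫⁻ ξ : ℂ, ENNReal.ofReal (‖ξ‖ ^ (s - 2)) *
        ‖charFun (P.map fun ω => S ω p.1 - S ω p.2) (-(2 * Real.pi) • ξ)‖ₑ) ∂(ν.prod ν) := by
  have hweight : Measurable fun ξ : ℂ => ENNReal.ofReal (‖ξ‖ ^ (s - 2)) := by fun_prop
  have himage : Measurable fun z : Ω × ℂ => charFun (ν.map (S z.1)) (-(2 * Real.pi) • z.2) :=
    (measurable_charFun_map hS).comp (by fun_prop : Measurable fun z : Ω × ℂ =>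
      (z.1, -(2 * Real.pi) • z.2))
  have hincr : Measurable fun z : ℂ × X × X =>
      charFun (P.map fun ω => S ω z.2.1 - S ω z.2.2) (-(2 * Real.pi) • z.1) := by
    refine (measurable_charFun_map (S := fun (p : X × X) ω => S ω p.1 - S ω p.2)
      (Measurable.sub ?_ ?_)).comp (by fun_prop : Measurable fun z : ℂ × X × X =>
        (z.2, -(2 * Real.pi) • z.1))
    · exact hS.comp (by fun_prop : Measurable fun z : (X × X) × Ω => (z.2, z.1.1))
    · exact hS.comp (by fun_prop : Measurable fun z : (X × X) × Ω => (z.2, z.1.2))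
  simp only [sobolevEnergy_eq_lintegral_charFun]
  calc ∫⁻ ω, (∫⁻ ξ : ℂ, ENNReal.ofReal (‖ξ‖ ^ (s - 2)) *
        ‖charFun (ν.map (S ω)) (-(2 * Real.pi) • ξ)‖ₑ ^ 2) ∂P
      = ∫⁻ ξ : ℂ, ENNReal.ofReal (‖ξ‖ ^ (s - 2)) *
        ∫⁻ ω, ‖charFun (ν.map (S ω)) (-(2 * Real.pi) • ξ)‖ₑ ^ 2 ∂P := by
        rw [lintegral_lintegral_swap
          ((hweight.comp measurable_snd).mul (himage.enorm.pow_const 2)).aemeasurable]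
        simp only [lintegral_const_mul' _ _ ENNReal.ofReal_ne_top]
    _ ≤ ∫⁻ ξ : ℂ, ENNReal.ofReal (‖ξ‖ ^ (s - 2)) * ∫⁻ p : X × X,
        ‖charFun (P.map fun ω => S ω p.1 - S ω p.2) (-(2 * Real.pi) • ξ)‖ₑ ∂(ν.prod ν) := by
        gcongr
        exact lintegral_enorm_charFun_map_sq_le hS _
    _ = _ := by
        simp only [← lintegral_const_mul' _ _ ENNReal.ofReal_ne_top]
        exact lintegral_lintegral_swap ((hweight.comp measurable_fst).mul hincr.enorm).aemeasurable

/-- The constant `∫ |ξ|^(s-2) (1 + |ξ|²)^(-N) dξ` over the plane, the Sobolev weight of a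
characteristic function with decay of order `2N` at unit scale. -/
noncomputable def planarRadialIntegral (s N : ℝ) : ℝ≥0∞ :=
  ∫⁻ ξ : ℂ, ENNReal.ofReal (‖ξ‖ ^ (s - 2) * (1 + ‖ξ‖ ^ 2) ^ (-N))

lemma planarRadialIntegral_lt_top {s N : ℝ} (hs : 0 < s) (hN : s < 2 * N) :
    planarRadialIntegral s N < ∞ := by
  simpa only [planarRadialIntegral, Complex.finrank_real_complex, Nat.cast_ofNat] using
    lintegral_norm_rpow_mul_one_add_sq_rpow_lt_top (volume : Measure ℂ) hs hN

lemma lintegral_rpow_mul_enorm_charFun_le {μ : Measure ℂ} {s N R : ℝ} (hR : 0 < R)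
    (hμ : ∀ t, ‖charFun μ t‖ ≤ (1 + (R * ‖t‖) ^ 2) ^ (-N)) :
    ∫⁻ ξ : ℂ, ENNReal.ofReal (‖ξ‖ ^ (s - 2)) * ‖charFun μ (-(2 * Real.pi) • ξ)‖ₑ ≤
      ENNReal.ofReal ((2 * Real.pi * R) ^ (-s)) * planarRadialIntegral s N := by
  have hscale := lintegral_norm_rpow_mul_one_add_mul_sq_rpow (volume : Measure ℂ) (s := s) (N := N)
    (by positivity : 0 < 2 * Real.pi * R)
  rw [Complex.finrank_real_complex, Nat.cast_ofNat] at hscale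
  rw [planarRadialIntegral, ← hscale]
  refine lintegral_mono fun ξ => ?_
  rw [← ofReal_norm, ← ENNReal.ofReal_mul (by positivity)]
  gcongr
  refine (hμ _).trans_eq ?_
  rw [norm_smul, norm_neg, Real.norm_of_nonneg Real.two_pi_pos.le, mul_left_comm, ← mul_assoc]

theorem ae_sobolevEnergy_lt_top [MetricSpace X] [SecondCountableTopology X] [MeasurableSpace X]
    [BorelSpace X] {P : Measure Ω} [IsFiniteMeasure P] {ν : Measure X} [IsFiniteMeasure ν]
    {S : Ω → X → ℂ} (hS : Measurable (Function.uncurry S)) {s τ N b : ℝ} (hs : 0 < s) (hτ : 0 < τ)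
    (hN : s < 2 * N) (hb : 0 < b)
    (hdecay : ∀ᵐ p ∂(ν.prod ν), p.1 ≠ p.2 → ∀ t,
      ‖charFun (P.map fun ω => S ω p.1 - S ω p.2) t‖ ≤
        (1 + (b * dist p.1 p.2 ^ τ * ‖t‖) ^ 2) ^ (-N))
    (hen : ∫⁻ x, ∫⁻ y, edist x y ^ (-(s * τ)) ∂ν ∂ν < ∞) :
    ∀ᵐ ω ∂P, sobolevEnergy (ν.map (S ω)) s < ∞ := by
  set C := ENNReal.ofReal ((2 * Real.pi * b) ^ (-s)) * planarRadialIntegral s N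
  have hC : C < ∞ := ENNReal.mul_lt_top ENNReal.ofReal_lt_top (planarRadialIntegral_lt_top hs hN)
  have hpair : ∀ᵐ p ∂(ν.prod ν), ∫⁻ ξ : ℂ, ENNReal.ofReal (‖ξ‖ ^ (s - 2)) *
      ‖charFun (P.map fun ω => S ω p.1 - S ω p.2) (-(2 * Real.pi) • ξ)‖ₑ ≤
        (C + 1) * edist p.1 p.2 ^ (-(s * τ)) := by
    filter_upwards [hdecay] with p hp
    rcases eq_or_ne p.1 p.2 with heq | hne
    · simp [heq, ENNReal.zero_rpow_of_neg (neg_lt_zero.2 (mul_pos hs hτ)), ENNReal.mul_top]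
    have hd : 0 < dist p.1 p.2 := dist_pos.2 hne
    refine (lintegral_rpow_mul_enorm_charFun_le (by positivity) (hp hne)).trans ?_
    rw [← mul_assoc, Real.mul_rpow (by positivity) (by positivity), ← Real.rpow_mul hd.le,
      ENNReal.ofReal_mul (by positivity), mul_right_comm, edist_dist,
      ENNReal.ofReal_rpow_of_pos hd, mul_neg, mul_comm τ]
    gcongr
    exact le_self_add
  have hmeas : Measurable fun ω => sobolevEnergy (ν.map (S ω)) s := by
    have hweight : Measurable fun z : Ω × ℂ => ENNReal.ofReal (‖z.2‖ ^ (s - 2)) := by fun_prop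
    have := (measurable_charFun_map (P := ν) hS).comp
      (by fun_prop : Measurable fun z : Ω × ℂ => (z.1, -(2 * Real.pi) • z.2))
    simp only [sobolevEnergy_eq_lintegral_charFun]
    exact (hweight.mul (this.enorm.pow_const 2)).lintegral_prod_right'
  refine ae_lt_top hmeas (ne_of_lt ?_)
  calc ∫⁻ ω, sobolevEnergy (ν.map (S ω)) s ∂P
      ≤ ∫⁻ p, (C + 1) * edist p.1 p.2 ^ (-(s * τ)) ∂(ν.prod ν) :=
        (lintegral_sobolevEnergy_map_le hS s).trans (lintegral_mono_ae hpair)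
    _ = (C + 1) * ∫⁻ x, ∫⁻ y, edist x y ^ (-(s * τ)) ∂ν ∂ν := by
        rw [lintegral_const_mul _ (by fun_prop), lintegral_prod _ (by fun_prop)]
    _ < ∞ := ENNReal.mul_lt_top (ENNReal.add_lt_top.2 ⟨hC, ENNReal.one_lt_top⟩) hen

lemma le_sobolevDim_image [TopologicalSpace X] [MeasurableSpace X] [BorelSpace X] {f : X → ℂ}
    (hf : Continuous f) {A K : Set X} (hKA : K ⊆ A) (hK : IsCompact K) {ν : Measure X}
    [IsFiniteMeasure ν] (hν : ν ≠ 0) (hνK : ν Kᶜ = 0) {s : ℝ≥0} (hs : 0 < s)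
    (hen : sobolevEnergy (ν.map f) s < ∞) :
    (s : ℝ≥0∞) ≤ sobolevDim (f '' A) := by
  have hsupp : SupportedMeasure (f '' A) (ν.map f) := by
    refine ⟨inferInstance, (Measure.map_ne_zero_iff hf.aemeasurable).2 hν, f '' K, hK.image hf,
      Set.image_mono hKA, ?_⟩
    rw [Measure.map_apply hf.measurable (hK.image hf).measurableSet.compl]
    exact measure_mono_null (fun x hx hxK => hx ⟨x, hxK, rfl⟩) hνK
  calc (s : ℝ≥0∞) ≤ sobolevDimMeasure (ν.map f) :=
        le_iSup₂ (f := fun (s : ℝ≥0) (_ : 0 < s ∧ sobolevEnergy (ν.map f) s < ∞) => (s : ℝ≥0∞))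
          s ⟨hs, hen⟩
    _ ≤ sobolevDim (f '' A) :=
        le_iSup₂ (f := fun (μ : Measure ℂ) (_ : SupportedMeasure (f '' A) μ) =>
          sobolevDimMeasure μ) (ν.map f) hsupp

end SobolevEnergy

/-! ### Heavy blocks of coefficients -/

/-- The block of frequencies `[q^k, q^(k+1))` has `ℓ²` mass at least `q^(-τk)`, witnessed by the
finite set `F` of indices. -/
structure IsHeavyBlock (q : ℝ) (lam : ℕ → ℝ) (a : ℕ → ℂ) (τ : ℝ) (k : ℕ) (F : Finset ℕ) :
    Prop where
  pow_le : ∀ n ∈ F, q ^ k ≤ lam n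
  lt_pow_succ : ∀ n ∈ F, lam n < q ^ (k + 1)
  sq_le_sum : ((q ^ k) ^ (-τ)) ^ 2 ≤ ∑ n ∈ F, ‖a n‖ ^ 2

/-- The coefficient of `e^{2πiθₙ}` in the increment of the random series between `y` and `x`. -/
noncomputable def phaseIncrement (a : ℕ → ℂ) (lam : ℕ → ℝ) (φ : ℕ → ℝ → ℂ) (x y : ℝ) (n : ℕ) : ℂ :=
  a n * (φ n (lam n * x) - φ n (lam n * y))

section HeavyBlock

variable {q τ : ℝ} {lam : ℕ → ℝ} {a : ℕ → ℂ}

lemma IsHeavyBlock.disjoint (hq : 1 ≤ q) {j k : ℕ} {F G : Finset ℕ}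
    (hF : IsHeavyBlock q lam a τ j F) (hG : IsHeavyBlock q lam a τ k G) (hjk : j ≠ k) :
    Disjoint F G := by
  wlog hlt : j < k generalizing j k F G
  · exact (this hG hF hjk.symm (by omega)).symm
  refine Finset.disjoint_left.2 fun n hnF hnG => ?_
  have := pow_le_pow_right₀ hq (Nat.succ_le_of_lt hlt)
  exact absurd (hF.lt_pow_succ n hnF) (this.trans (hG.pow_le n hnG)).not_gt

lemma eventually_rpow_lt_blockNorm (hq : 1 < q) (h : decayExponent q lam a < (τ : EReal)) :
    ∀ᶠ k : ℕ in atTop, (q ^ k) ^ (-τ) < blockNorm q lam a k := by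
  filter_upwards [eventually_lt_of_limsup_lt h, eventually_ge_atTop 1] with k hk hk1
  have hlog : 0 < k * Real.log q := mul_pos (by exact_mod_cast hk1) (Real.log_pos hq)
  rcases le_or_gt (blockNorm q lam a k) 0 with hzero | hpos
  · rw [ENNReal.log_ofReal, if_pos hzero, EReal.neg_bot, EReal.top_div_of_pos_ne_top
      (by exact_mod_cast hlog) (EReal.coe_ne_top _)] at hk
    exact absurd hk not_top_lt
  · rw [ENNReal.log_ofReal_of_pos hpos, ← EReal.coe_neg, ← EReal.coe_div, EReal.coe_lt_coe_iff,
      div_lt_iff₀ hlog] at hk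
    rw [← Real.log_lt_log_iff (by positivity) hpos, Real.log_rpow (by positivity), Real.log_pow]
    linarith

lemma exists_isHeavyBlock_of_lt_blockNorm (hq : 0 ≤ q) {k : ℕ}
    (h : (q ^ k) ^ (-τ) < blockNorm q lam a k) : ∃ F, IsHeavyBlock q lam a τ k F := by
  classical
  set f : ℕ → ℝ := fun n => if q ^ k ≤ lam n ∧ lam n < q ^ (k + 1) then ‖a n‖ ^ 2 else 0
  have hlt : ((q ^ k) ^ (-τ)) ^ 2 < ∑' n, f n := by
    convert (Real.lt_sqrt (by positivity)).1 h
  have hf : Summable f := by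
    by_contra hns
    rw [tsum_eq_zero_of_not_summable hns] at hlt
    exact hlt.not_ge (sq_nonneg _)
  obtain ⟨F, hF⟩ := (hf.hasSum.eventually (lt_mem_nhds hlt)).exists
  refine ⟨F.filter fun n => q ^ k ≤ lam n ∧ lam n < q ^ (k + 1), ?_, ?_, ?_⟩
  · exact fun n hn => (Finset.mem_filter.1 hn).2.1
  · exact fun n hn => (Finset.mem_filter.1 hn).2.2
  · exact by simpa only [Finset.sum_filter] using hF.le

lemma exists_forall_ge_isHeavyBlock (hq : 1 < q) (h : decayExponent q lam a < (τ : EReal)) :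
    ∃ k₀ : ℕ, ∀ k ≥ k₀, ∃ F, IsHeavyBlock q lam a τ k F := by
  obtain ⟨k₀, hk₀⟩ := eventually_atTop.1 (eventually_rpow_lt_blockNorm hq h)
  exact ⟨k₀, fun k hk => exists_isHeavyBlock_of_lt_blockNorm (by linarith) (hk₀ k hk)⟩

end HeavyBlock

section BlockDecay

lemma one_add_sum_le_prod_one_add {ι R : Type*} [CommRing R] [LinearOrder R]
    [IsStrictOrderedRing R] (F : Finset ι) {f : ι → R} (hf : ∀ i, 0 ≤ f i) :
    1 + ∑ i ∈ F, f i ≤ ∏ i ∈ F, (1 + f i) := by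
  classical
  induction F using Finset.induction_on with
  | empty => simp
  | insert i F hi ih =>
    rw [Finset.sum_insert hi, Finset.prod_insert hi]
    nlinarith [hf i, mul_nonneg (hf i) (Finset.sum_nonneg fun j (_ : j ∈ F) => hf j)]

variable {f : ℝ → ℝ} {κ : ℝ}

lemma prod_le_one_add_sq_rpow {ι : Type*} (hf0 : ∀ t, 0 ≤ f t)
    (hf : ∀ t, 0 ≤ t → f t ≤ (1 + t ^ 2) ^ (-κ)) (hκ : 0 ≤ κ) (F : Finset ι) {t : ι → ℝ}
    (ht : ∀ i, 0 ≤ t i) {B : ℝ} (hB : B ^ 2 ≤ ∑ i ∈ F, t i ^ 2) :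
    ∏ i ∈ F, f (t i) ≤ (1 + B ^ 2) ^ (-κ) := by
  calc ∏ i ∈ F, f (t i) ≤ ∏ i ∈ F, (1 + t i ^ 2) ^ (-κ) :=
        Finset.prod_le_prod (fun _ _ => hf0 _) fun i _ => hf _ (ht i)
    _ = (∏ i ∈ F, (1 + t i ^ 2)) ^ (-κ) := Real.finsetProd_rpow _ _ (fun i _ => by positivity) _
    _ ≤ (1 + B ^ 2) ^ (-κ) :=
        Real.rpow_le_rpow_of_nonpos (by positivity) ((add_le_add_right hB 1).trans
          (one_add_sum_le_prod_one_add F fun i => sq_nonneg (t i))) (neg_nonpos.2 hκ)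

lemma rpow_le_mul_rpow_neg {δ ρ r τ Q : ℝ} (hδ : 0 < δ) (hr : 0 < r) (hτ : 0 ≤ τ) (hQ : 0 < Q)
    (hQr : Q * r ≤ δ) (hρQ : ρ ≤ Q * r) :
    ρ / δ ^ τ * r ^ τ ≤ Q * r * Q ^ (-τ) := by
  have hrQ : r / δ ≤ Q⁻¹ := by rwa [div_le_iff₀ hδ, inv_mul_eq_div, le_div_iff₀' hQ]
  calc ρ / δ ^ τ * r ^ τ = ρ * (r / δ) ^ τ := by rw [Real.div_rpow hr.le hδ.le]; ring
    _ ≤ Q * r * (Q⁻¹) ^ τ := by gcongr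
    _ = Q * r * Q ^ (-τ) := by rw [Real.inv_rpow hQ.le, Real.rpow_neg hQ.le]

variable {φ : ℕ → ℝ → ℂ} {a : ℕ → ℂ} {lam : ℕ → ℝ} {c δ q τ : ℝ}

lemma mul_norm_le_norm_phaseIncrement (hc : 0 ≤ c)
    (hφ : ∀ n x y, |x - y| ≤ δ → c * |x - y| ≤ ‖φ n x - φ n y‖) {x y Q : ℝ} {n : ℕ} (hQ : 0 ≤ Q)
    (hQn : Q ≤ lam n) (hn : lam n * |x - y| ≤ δ) :
    c * (Q * |x - y|) * ‖a n‖ ≤ ‖phaseIncrement a lam φ x y n‖ := by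
  have habs : |lam n * x - lam n * y| = lam n * |x - y| := by
    rw [← mul_sub, abs_mul, abs_of_nonneg (hQ.trans hQn)]
  rw [phaseIncrement, norm_mul, mul_comm ‖a n‖]
  gcongr
  calc c * (Q * |x - y|) ≤ c * |lam n * x - lam n * y| := by rw [habs]; gcongr
    _ ≤ _ := hφ n _ _ (habs.trans_le hn)

lemma IsHeavyBlock.prod_le (hf0 : ∀ t, 0 ≤ f t) (hf : ∀ t, 0 ≤ t → f t ≤ (1 + t ^ 2) ^ (-κ))
    (hκ : 0 ≤ κ) (hc : 0 ≤ c) (hδ : 0 < δ)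
    (hφ : ∀ n x y, |x - y| ≤ δ → c * |x - y| ≤ ‖φ n x - φ n y‖) (hq : 1 ≤ q) (hτ : 0 ≤ τ) {k : ℕ}
    {F : Finset ℕ} (hF : IsHeavyBlock q lam a τ k F) {x y ρ : ℝ} (hxy : x ≠ y)
    (hle : q ^ (k + 1) * |x - y| ≤ δ) (hρ : 0 ≤ ρ) (hge : ρ ≤ q ^ k * |x - y|) {u : ℝ}
    (hu : 0 ≤ u) :
    ∏ n ∈ F, f (u * ‖phaseIncrement a lam φ x y n‖) ≤
      (1 + (c * (ρ / δ ^ τ) * |x - y| ^ τ * u) ^ 2) ^ (-κ) := by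
  have : 0 < q := by linarith
  set Q := q ^ k
  have hQ0 : 0 < Q := by positivity
  set d := |x - y|
  have hd : 0 < d := abs_pos.2 (sub_ne_zero.2 hxy)
  have hQd : Q * d ≤ δ := (mul_le_mul_of_nonneg_right
    (pow_le_pow_right₀ hq (Nat.le_succ k)) hd.le).trans hle
  have hscale : ρ / δ ^ τ * d ^ τ ≤ Q * d * Q ^ (-τ) :=
    rpow_le_mul_rpow_neg hδ hd hτ hQ0 hQd hge
  refine prod_le_one_add_sq_rpow hf0 hf hκ F (fun n => by positivity) ?_
  calc (c * (ρ / δ ^ τ) * d ^ τ * u) ^ 2 = (u * c * (ρ / δ ^ τ * d ^ τ)) ^ 2 := by ring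
    _ ≤ (u * c * (Q * d * Q ^ (-τ))) ^ 2 := by gcongr
    _ = (u * c * (Q * d)) ^ 2 * (Q ^ (-τ)) ^ 2 := by ring
    _ ≤ (u * c * (Q * d)) ^ 2 * ∑ n ∈ F, ‖a n‖ ^ 2 := by
        gcongr
        exact hF.sq_le_sum
    _ = ∑ n ∈ F, (u * (c * (Q * d) * ‖a n‖)) ^ 2 := by
        rw [Finset.mul_sum]
        exact Finset.sum_congr rfl fun n _ => by ring
    _ ≤ ∑ n ∈ F, (u * ‖phaseIncrement a lam φ x y n‖) ^ 2 := by
        gcongr with n hn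
        exact mul_norm_le_norm_phaseIncrement hc hφ hQ0.le (hF.pow_le n hn)
          ((mul_le_mul_of_nonneg_right (hF.lt_pow_succ n hn).le hd.le).trans hle)

theorem exists_prod_le_of_decayExponent_lt (hf0 : ∀ t, 0 ≤ f t)
    (hf : ∀ t, 0 ≤ t → f t ≤ (1 + t ^ 2) ^ (-κ)) (hκ : 0 ≤ κ) (hc : 0 < c) (hδ : 0 < δ)
    (hφ : ∀ n x y, |x - y| ≤ δ → c * |x - y| ≤ ‖φ n x - φ n y‖) (hq : 1 < q) (hτ : 0 ≤ τ)
    (hdecay : decayExponent q lam a < (τ : EReal)) (m : ℕ) :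
    ∃ r > (0 : ℝ), ∃ b > (0 : ℝ), ∀ x y, x ≠ y → |x - y| ≤ r → ∃ F : Finset ℕ, ∀ u, 0 ≤ u →
      ∏ n ∈ F, f (u * ‖phaseIncrement a lam φ x y n‖) ≤
        (1 + (b * |x - y| ^ τ * u) ^ 2) ^ (-(κ * m)) := by
  obtain ⟨k₀, hk₀⟩ := exists_forall_ge_isHeavyBlock hq hdecay
  have : 0 < q := by linarith
  refine ⟨δ / q ^ (k₀ + m), by positivity, c * (δ / q ^ (m + 1) / δ ^ τ), by positivity,
    fun x y hxy hr => ?_⟩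
  set d := |x - y|
  have hd : 0 < d := abs_pos.2 (sub_ne_zero.2 hxy)
  have hstart : q ^ (k₀ + m) ≤ δ / d := (le_div_comm₀ hd (by positivity)).1 hr
  obtain ⟨N, hN, hN'⟩ := exists_nat_pow_near ((one_le_pow₀ hq.le).trans hstart) hq
  have hkN : k₀ + m < N + 1 := (pow_lt_pow_iff_right₀ hq).1 (hstart.trans_lt hN')
  choose F hF using fun i => hk₀ (N - m + i) (by omega)
  have hdisj : Set.PairwiseDisjoint (Finset.range m : Set ℕ) F := fun i _ j _ hij =>
    (hF i).disjoint hq.le (hF j) (by omega)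
  have hblock (u : ℝ) (hu : 0 ≤ u) (i : ℕ) (hi : i ∈ Finset.range m) :
      ∏ n ∈ F i, f (u * ‖phaseIncrement a lam φ x y n‖) ≤
        (1 + (c * (δ / q ^ (m + 1) / δ ^ τ) * d ^ τ * u) ^ 2) ^ (-κ) := by
    have hi' := Finset.mem_range.1 hi
    refine (hF i).prod_le hf0 hf hκ hc.le hδ hφ hq.le hτ hxy ?_ (by positivity) ?_ hu
    · rw [← le_div_iff₀ hd]
      exact (pow_le_pow_right₀ hq.le (by omega)).trans hN
    · rw [div_le_iff₀ (by positivity), mul_right_comm, ← pow_add, ← div_le_iff₀ hd]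
      exact hN'.le.trans (pow_le_pow_right₀ hq.le (by omega))
  refine ⟨(Finset.range m).biUnion F, fun u hu => ?_⟩
  rw [Finset.prod_biUnion hdisj]
  refine (Finset.prod_le_prod (fun i _ => Finset.prod_nonneg fun _ _ => hf0 _)
    (hblock u hu)).trans_eq ?_
  rw [Finset.prod_const, Finset.card_range, ← Real.rpow_mul_natCast (by positivity), neg_mul]

end BlockDecay

/-! ### The random series -/

section PhaseSeries

variable {φ : ℕ → ℝ → ℂ} {M : ℝ} {a : ℕ → ℂ} {lam : ℕ → ℝ}

lemma norm_mul_exp_mul_le (hφ : ∀ n x, ‖φ n x‖ ≤ M) (t : ℕ → ℝ) (n : ℕ) (x : ℝ) :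
    ‖a n * Complex.exp (2 * Real.pi * Complex.I * t n) * φ n (lam n * x)‖ ≤ ‖a n‖ * M := by
  rw [norm_mul, norm_mul, norm_exp_two_pi_I_mul, mul_one]
  exact mul_le_mul_of_nonneg_left (hφ _ _) (norm_nonneg _)

lemma hasSum_phaseSeries (hφ : ∀ n x, ‖φ n x‖ ≤ M) (ha : Summable fun n => ‖a n‖) (t : ℕ → ℝ)
    (x : ℝ) :
    HasSum (fun n => a n * Complex.exp (2 * Real.pi * Complex.I * t n) * φ n (lam n * x))
      (phaseSeries a lam φ t x) :=
  (Summable.of_norm_bounded (ha.mul_right M) fun n => norm_mul_exp_mul_le hφ t n x).hasSum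

lemma phaseSeries_sub_eq_tsum (hφ : ∀ n x, ‖φ n x‖ ≤ M) (ha : Summable fun n => ‖a n‖)
    (t : ℕ → ℝ) (x y : ℝ) :
    phaseSeries a lam φ t x - phaseSeries a lam φ t y =
      ∑' n, phaseIncrement a lam φ x y n * Complex.exp (2 * Real.pi * Complex.I * t n) := by
  rw [← ((hasSum_phaseSeries hφ ha t x).sub (hasSum_phaseSeries hφ ha t y)).tsum_eq]
  refine tsum_congr fun n => ?_
  rw [phaseIncrement]
  ring

lemma summable_norm_phaseIncrement (hφ : ∀ n x, ‖φ n x‖ ≤ M) (ha : Summable fun n => ‖a n‖)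
    (x y : ℝ) : Summable fun n => ‖phaseIncrement a lam φ x y n‖ := by
  refine Summable.of_nonneg_of_le (fun _ => norm_nonneg _) (fun n => ?_) (ha.mul_right (M + M))
  rw [phaseIncrement, norm_mul]
  gcongr
  exact (norm_sub_le _ _).trans (add_le_add (hφ _ _) (hφ _ _))

lemma continuous_phaseSeries (hφ : ∀ n x, ‖φ n x‖ ≤ M) (hφc : ∀ n, Continuous (φ n))
    (ha : Summable fun n => ‖a n‖) (t : ℕ → ℝ) : Continuous (phaseSeries a lam φ t) :=
  continuous_tsum (fun n => by fun_prop) (ha.mul_right M) fun n x => norm_mul_exp_mul_le hφ t n x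

variable {Ω : Type*} [MeasurableSpace Ω] {θ : ℕ → Ω → ℝ}

lemma measurable_uncurry_phaseSeries (hθ : ∀ n, Measurable (θ n)) (hφ : ∀ n x, ‖φ n x‖ ≤ M)
    (hφm : ∀ n, Measurable (φ n)) (ha : Summable fun n => ‖a n‖) :
    Measurable (Function.uncurry fun ω => phaseSeries a lam φ fun n => θ n ω) :=
  measurable_of_tendsto_metrizable
    (fun N => Finset.measurable_fun_sum (Finset.range N) fun n _ => by fun_prop)
    (tendsto_pi_nhds.2 fun p =>
      (hasSum_phaseSeries hφ ha (fun n => θ n p.1) p.2).tendsto_sum_nat)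

variable {P : Measure Ω}

lemma norm_charFun_phaseSeries_sub_le (hθ : ∀ n, Measurable (θ n)) (hind : iIndepFun θ P)
    (hunif : ∀ n, pdf.IsUniform (θ n) (Set.Icc 0 1) P volume) (hφ : ∀ n x, ‖φ n x‖ ≤ M)
    (ha : Summable fun n => ‖a n‖) (x y : ℝ) (F : Finset ℕ) (t : ℂ) :
    ‖charFun (P.map fun ω => phaseSeries a lam φ (fun n => θ n ω) x -
        phaseSeries a lam φ (fun n => θ n ω) y) t‖ ≤
      ∏ n ∈ F, |besselZero (‖t‖ * ‖phaseIncrement a lam φ x y n‖)| := by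
  simp only [phaseSeries_sub_eq_tsum hφ ha]
  exact norm_charFun_map_tsum_le hθ hind hunif (summable_norm_phaseIncrement hφ ha x y) F t

lemma exists_norm_charFun_phaseSeries_sub_le (hθ : ∀ n, Measurable (θ n)) (hind : iIndepFun θ P)
    (hunif : ∀ n, pdf.IsUniform (θ n) (Set.Icc 0 1) P volume) (hφ : ∀ n x, ‖φ n x‖ ≤ M)
    {c δ : ℝ} (hc : 0 < c) (hδ : 0 < δ)
    (hφ_lower : ∀ n x y, |x - y| ≤ δ → c * |x - y| ≤ ‖φ n x - φ n y‖)
    (ha : Summable fun n => ‖a n‖) {q τ : ℝ} (hq : 1 < q) (hτ : 0 ≤ τ)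
    (hdecay : decayExponent q lam a < (τ : EReal)) (N₀ : ℝ) :
    ∃ r > (0 : ℝ), ∃ b > (0 : ℝ), ∃ N > N₀, ∀ x y, x ≠ y → |x - y| ≤ r → ∀ t,
      ‖charFun (P.map fun ω => phaseSeries a lam φ (fun n => θ n ω) x -
          phaseSeries a lam φ (fun n => θ n ω) y) t‖ ≤
        (1 + (b * |x - y| ^ τ * ‖t‖) ^ 2) ^ (-N) := by
  obtain ⟨κ, hκ, hbessel⟩ := exists_abs_besselZero_le_rpow
  obtain ⟨m, hm⟩ := exists_nat_gt (N₀ / κ)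
  obtain ⟨r, hr, b, hb, hprod⟩ := exists_prod_le_of_decayExponent_lt (fun t => abs_nonneg _)
    hbessel hκ.le hc hδ hφ_lower hq hτ hdecay m
  refine ⟨r, hr, b, hb, κ * m, (div_lt_iff₀' hκ).1 hm, fun x y hxy hxyr t => ?_⟩
  obtain ⟨F, hF⟩ := hprod x y hxy hxyr
  exact (norm_charFun_phaseSeries_sub_le hθ hind hunif hφ ha x y F t).trans (hF _ (norm_nonneg t))

end PhaseSeries

lemma ae_forall_nnreal_le {Ω : Type*} [MeasurableSpace Ω] {P : Measure Ω} {f : Ω → ℝ≥0∞}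
    {I : Set ℝ≥0} (hI : IsLowerSet I) (h : ∀ s ∈ I, ∀ᵐ ω ∂P, (s : ℝ≥0∞) ≤ f ω) :
    ∀ᵐ ω ∂P, ∀ s ∈ I, (s : ℝ≥0∞) ≤ f ω := by
  obtain ⟨D, hDc, hD⟩ := TopologicalSpace.exists_countable_dense ℝ≥0
  have hae : ∀ᵐ ω ∂P, ∀ u ∈ D, u ∈ I → (u : ℝ≥0∞) ≤ f ω :=
    (ae_ball_iff hDc).2 fun u _ => eventually_imp_distrib_left.2 (h u)
  filter_upwards [hae] with ω hω s hs
  refine ENNReal.le_of_forall_nnreal_lt fun r hr => ?_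
  obtain ⟨u, huD, hru, hus⟩ := hD.exists_between (ENNReal.coe_lt_coe.1 hr)
  exact (ENNReal.coe_le_coe.2 hru.le).trans (hω u huD (hI hus.le hs))

section SobolevDimension

variable {Ω : Type*} [MeasurableSpace Ω] {P : Measure Ω}
  {θ : ℕ → Ω → ℝ} {φ : ℕ → ℝ → ℂ} {M c δ : ℝ} {a : ℕ → ℂ} {lam : ℕ → ℝ} {q : ℝ} {A : Set ℝ}

lemma ae_le_sobolevDim_phaseSeries_image (hθ_meas : ∀ n, Measurable (θ n))
    (hθ_indep : iIndepFun θ P) (hθ_unif : ∀ n, pdf.IsUniform (θ n) (Set.Icc 0 1) P volume)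
    (hφ_bdd : ∀ n x, ‖φ n x‖ ≤ M) (hφ_cont : ∀ n, Continuous (φ n)) (hc : 0 < c) (hδ : 0 < δ)
    (hφ_lower : ∀ n x y, |x - y| ≤ δ → c * |x - y| ≤ ‖φ n x - φ n y‖)
    (ha_sum : Summable fun n => ‖a n‖) (hq : 1 < q) (hA : AnalyticSet A) {s : ℝ≥0} (hs : 0 < s)
    {τ : ℝ} (hτ : 0 < τ) (hdecay : decayExponent q lam a < (τ : EReal))
    (hdim : ENNReal.ofReal (s * τ) < dimH A) :
    ∀ᵐ ω ∂P, (s : ℝ≥0∞) ≤ sobolevDim (phaseSeries a lam φ (fun n => θ n ω) '' A) := by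
  have := hθ_indep.isProbabilityMeasure
  have hs' : (0 : ℝ) < s := hs
  obtain ⟨r, hr, b, hb, N, hN, hchar⟩ := exists_norm_charFun_phaseSeries_sub_le hθ_meas hθ_indep
    hθ_unif hφ_bdd hc hδ hφ_lower ha_sum hq hτ.le hdecay (s / 2)
  obtain ⟨K, hKA, hK, hKr, ν, hfin, hν, hνK, henergy⟩ :=
    exists_measure_energy_lt_top hA (mul_pos hs' hτ) hdim hr
  have hmem : ∀ᵐ x ∂ν, x ∈ K := hνK
  have hpair : ∀ᵐ p ∂(ν.prod ν), p.1 ∈ K ∧ p.2 ∈ K :=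
    (Measure.quasiMeasurePreserving_fst.ae hmem).and (Measure.quasiMeasurePreserving_snd.ae hmem)
  filter_upwards [ae_sobolevEnergy_lt_top
    (measurable_uncurry_phaseSeries hθ_meas hφ_bdd (fun n => (hφ_cont n).measurable) ha_sum) hs'
    hτ (by linarith) hb (hpair.mono fun p hp hne => hchar p.1 p.2 hne (hKr _ hp.1 _ hp.2))
    henergy] with ω hω
  exact le_sobolevDim_image (continuous_phaseSeries hφ_bdd hφ_cont ha_sum _) hKA hK hν hνK hs hω

theorem theorem3p4_general (hθ_meas : ∀ n, Measurable (θ n)) (hθ_indep : iIndepFun θ P)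
    (hθ_unif : ∀ n, pdf.IsUniform (θ n) (Set.Icc 0 1) P volume)
    (hφ_bdd : ∀ n x, ‖φ n x‖ ≤ M) (hφ_cont : ∀ n, Continuous (φ n)) (hc : 0 < c) (hδ : 0 < δ)
    (hφ_lower : ∀ n x y, |x - y| ≤ δ → c * |x - y| ≤ ‖φ n x - φ n y‖)
    (ha_sum : Summable fun n => ‖a n‖) (hq : 1 < q) {τ : ℝ≥0}
    (hτ : decayExponent q lam a ≤ ((τ : ℝ) : EReal)) (hA : AnalyticSet A) :
    ∀ᵐ ω ∂P, ∀ s : ℝ≥0, (s : ℝ≥0∞) * τ < dimH A →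
      (s : ℝ≥0∞) ≤ sobolevDim (phaseSeries a lam φ (fun n => θ n ω) '' A) := by
  refine ae_forall_nnreal_le (I := {s : ℝ≥0 | (s : ℝ≥0∞) * τ < dimH A})
    (fun s u hus (hs : _ < _) => (by gcongr : (u : ℝ≥0∞) * τ ≤ s * τ).trans_lt hs) fun s hsA => ?_
  rcases eq_or_ne s 0 with rfl | hs0
  · simp
  have hs : 0 < s := pos_iff_ne_zero.2 hs0
  obtain ⟨d, hsd, hdA⟩ := ENNReal.lt_iff_exists_nnreal_btwn.1 hsA
  have hττ' : τ < d / s := (lt_div_iff₀' hs).2 (by exact_mod_cast hsd)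
  refine ae_le_sobolevDim_phaseSeries_image hθ_meas hθ_indep hθ_unif hφ_bdd hφ_cont hc hδ hφ_lower
    ha_sum hq hA hs (τ := (d / s : ℝ≥0)) (NNReal.coe_pos.2 (zero_le.trans_lt hττ'))
    (hτ.trans_lt (by exact_mod_cast hττ')) ?_
  rwa [← NNReal.coe_mul, mul_div_cancel₀ _ hs0, ENNReal.ofReal_coe_nnreal]

end SobolevDimension

theorem theorem3p4
    {Ω : Type*} [MeasurableSpace Ω] (P : Measure Ω) [IsProbabilityMeasure P]
    (θ : ℕ → Ω → ℝ) (hθ_meas : ∀ n, Measurable (θ n)) (hθ_indep : iIndepFun θ P)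
    (hθ_unif : ∀ n, pdf.IsUniform (θ n) (Set.Icc 0 1) P volume)
    (φ : ℕ → ℝ → ℂ) (M : ℝ) (hφ_bdd : ∀ n x, ‖φ n x‖ ≤ M)
    (L δ : ℝ) (hL : 1 ≤ L) (hδ : 0 < δ)
    (hφ_lip : ∀ n x y, |x - y| ≤ δ →
      L⁻¹ * |x - y| ≤ ‖φ n x - φ n y‖ ∧ ‖φ n x - φ n y‖ ≤ L * |x - y|)
    (a : ℕ → ℂ) (ha_ne : ∀ n, a n ≠ 0) (ha_sum : Summable fun n => ‖a n‖)
    (lam : ℕ → ℝ) (hlam_mono : Monotone lam) (hlam_zero : lam 0 = 1)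
    (q : ℝ) (hq : IsLUB (Set.range fun n => lam (n + 1) / lam n) q) (hq_one : 1 < q)
    (τ : ℝ≥0) (hτ : decayExponent q lam a = ((τ : ℝ) : EReal))
    (A : Set ℝ) (hA : MeasurableSet A) (hA_dim : 0 < dimH A) :
    ∀ᵐ ω ∂P,
      dimH A / (τ : ℝ≥0∞) ≤ sobolevDim (phaseSeries a lam φ (fun n => θ n ω) '' A) := by
  have hφ_cont (n : ℕ) : Continuous (φ n) := continuous_iff_continuousAt.2 fun x =>
    continuousAt_of_locally_lipschitz hδ L fun y hyx => by
      simpa only [Real.dist_eq, Complex.dist_eq] using (hφ_lip n y x hyx.le).2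
  filter_upwards [theorem3p4_general hθ_meas hθ_indep hθ_unif hφ_bdd hφ_cont
    (inv_pos.2 (zero_lt_one.trans_le hL)) hδ (fun n x y hxy => (hφ_lip n x y hxy).1) ha_sum hq_one
    hτ.le hA.analyticSet] with ω hω
  exact ENNReal.le_of_forall_nnreal_lt fun s hs => hω s (ENNReal.mul_lt_of_lt_div hs)
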